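/- **Leaky MoE entropic uncertainty relation.** Let $n$ be an even natural number, $V=\mathbb{Z}_2^n$, $T=T'=\mathbb{Z}_2^{n/2}$, and let $A$ be either the set of all subspaces of $V$ of dimension $n/2$ or the set of all such subspaces that are spanned by canonical basis vectors. For every subspace $a\subseteq V$ of dimension $n/2$ fix a linear map $t\mapsto t_a$ from $\mathbb{Z}_2^{n/2}$ to $V$ such that $t\mapsto t_a+a$ is an isomorphism onto $V/a$, and for $t,t'\in\mathbb{Z}_2^{n/2}$ let $$|a_{t,t'}\rangle=\frac{1}{\sqrt{|a|}}\sum_{u\in a}(-1)^{u\cdot t'_{a^\perp}}|u+t_a\rangle,\qquad a^\perp=\{v\in V: u\cdot v=0\ \forall u\in a\}.$$ Let $B,C$ be finite-dimensional quantum registers, let $\Phi:\mathcal{L}(V)\to\mathcal{L}(BC)$ be a quantum channel (completely positive and trace preserving), and let $$\rho_{AA'TT'BC}=\mathop{\mathbb{E}}_{a\in A;\ t,t'\in\mathbb{Z}_2^{n/2}}|a,a,t,t'\rangle\langle a,a,t,t'|\otimes\Phi(|a_{t,t'}\rangle\langle a_{t,t'}|)$$ be the resulting state of the leaky monogamy-of-entanglement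 game, where the expectation is uniform and $A'$ holds a copy of the subspace $a$. Then for every POVM $M=(M_t)_{t\in T}$ of Bob on $AB$, $$H_{\min}(T|M(AB))_{\rho}+H_{\min}(T'|A'TC)_{\rho_{|(M(AB)=T)}}\;\geq\;\Big(-\lg\cos\frac{\pi}{8}\Big)n-\frac{1}{2\ln 2}.$$ Here $\lg=\log_2$. Writing $\rho_{AA'TT'BC}=\sum_{t}|t\rangle\langle t|_T\otimes\rho^{t}_{AA'T'BC}$, the partial state of the event that Bob guesses correctly is $\rho_{\wedge(M(AB)=T)}=\sum_t |t\rangle\langle t|_T\otimes\sqrt{M_t}\,\rho^{t}_{AA'T'BC}\sqrt{M_t}$, the conditional state is $\rho_{|(M(AB)=T)}=\rho_{\wedge(M(AB)=T)}/\mathrm{Tr}\,\rho_{\wedge(M(AB)=T)}$, the guessing entropy is $H_{\min}(T|M(AB))_\rho=-\lg\mathrm{Tr}\,\rho_{\wedge(M(AB)=T)}$, and for registers $X,Y$ the conditional min-entropy is $H_{\min}(X|Y)_\tau=-\lg\inf\{\mathrm{Tr}\,\sigma_Y:\ \tau_{XY}\leq \mathbb{1}_X\otimes\sigma_Y,\ \sigma_Y\geq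 0\}$. Entropies take values in $(-\infty,+\infty]$ with $-\lg 0=+\infty$; if Bob never guesses correctly, the first term is $+\infty$ and the inequality holds by convention. -/

import Mathlib

open scoped Matrix Kronecker MatrixOrder ComplexOrder

noncomputable section

namespace CosetMoE

/-! ### Finite registers, states, measurements and channels

A register is a finite type `X`; its Hilbert space is `X → ℂ` with the standard inner product, and
operators on it are square matrices in the register basis.  Tensor products of Hilbert spaces are
indexed by products of registers. -/

/-- Linear operators on the Hilbert space of the register `X`. -/
abbrev Op (X : Type*) := Matrix X X ℂ

/-- The classical state `[x] = |x⟩⟨x|`. -/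
def cstate {X : Type*} [DecidableEq X] (x : X) : Op X := Matrix.single x x 1

/-- The rank one operator `|ψ⟩⟨ψ|`. -/
def ketbra {X : Type*} (ψ : X → ℂ) : Op X := Matrix.vecMulVec ψ (star ψ)

/-- Renaming of registers: `e` reads the registers of the old state off from those of the new. -/
def relabel {X Y : Type*} (e : X → Y) (ρ : Op Y) : Op X := ρ.submatrix e e

/-- Partial trace over the first register. -/
def trFst {X Y : Type*} [Fintype X] (ρ : Op (X × Y)) : Op Y :=
  Matrix.of fun y y' => ∑ x, ρ (x, y) (x, y')

/-- The operator `(id_Z ⊗ Φ)(ρ)`: `Φ` is applied to each block of `ρ` over the register `Z`. -/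
def idTensor (Z : Type*) {X Y : Type*} (Φ : Op X →ₗ[ℂ] Op Y) (ρ : Op (Z × X)) : Op (Z × Y) :=
  Matrix.of fun p q => Φ (Matrix.of fun x x' => ρ (p.1, x) (q.1, x')) p.2 q.2

/-- Quantum channels: completely positive trace-preserving maps. -/
structure IsChannel {X Y : Type*} [Fintype X] [Fintype Y] (Φ : Op X →ₗ[ℂ] Op Y) : Prop where
  completely_positive : ∀ (Z : Type) [Fintype Z] (P : Op (Z × X)),
    P.PosSemidef → (idTensor Z Φ P).PosSemidef
  trace_preserving : ∀ P : Op X, (Φ P).trace = P.trace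

/-- Positive operator-valued measurements on `X` with outcomes in `S`. -/
structure IsPOVM {S X : Type*} [Fintype S] [DecidableEq X] (P : S → Op X) : Prop where
  posSemidef : ∀ s, (P s).PosSemidef
  sum_eq_one : ∑ s, P s = 1

/-- The nondestructive measurement channel `ρ ↦ ∑ s, [s] ⊗ √P_s ρ √P_s`. -/
def ndMeasure {S X : Type*} [Fintype S] [DecidableEq S] [Fintype X] [DecidableEq X] (P : S → Op X) :
    Op X →ₗ[ℂ] Op (S × X) where
  toFun ρ := ∑ s, cstate s ⊗ₖ (CFC.sqrt (P s) * ρ * CFC.sqrt (P s))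
  map_add' ρ τ := by
    simp only [Matrix.mul_add, Matrix.add_mul, Matrix.kronecker_add, Finset.sum_add_distrib]
  map_smul' c ρ := by
    simp only [Matrix.mul_smul, Matrix.smul_mul, Matrix.kronecker_smul, Finset.smul_sum,
      RingHom.id_apply]

/-- The partial state `ρ_{∧Ω} = ∑_{x ∈ Ω} [x] ⊗ p_x ρ^x` of a state `∑ x, [x] ⊗ p_x ρ^x` that is
classical on `X`, for an event `Ω ⊆ X`. -/
def partialState {X Y : Type*} [DecidableEq X] (Ω : X → Prop) [DecidablePred Ω]
    (ρ : Op (X × Y)) : Op (X × Y) :=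
  Matrix.of fun p q => if p.1 = q.1 ∧ Ω p.1 then ρ p q else 0

/-- The partial state `ρ_{∧(M(A) = X)}` of a state `ρ` on the registers `X A R` that is classical
on `X`: the register `A` is measured by the nondestructive channel of `M`, the partial state of the
event that the outcome equals the value of `X` is taken, and the outcome is traced out. -/
def partialGuess {X A R : Type*} [Fintype X] [DecidableEq X] [Fintype A] [DecidableEq A]
    (M : X → Op A) (ρ : Op (X × A × R)) : Op (X × A × R) :=
  -- the registers of `measured` are `X R` and `S A`, where `S` holds the outcome
  let measured : Op ((X × R) × (X × A)) :=
    idTensor (X × R) (ndMeasure M)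
      (relabel (fun p : (X × R) × A => (p.1.1, p.2, p.1.2)) ρ)
  -- the partial state is on the classical registers `S X` and the remaining registers `A R`
  let selected : Op ((X × X) × (A × R)) :=
    partialState (fun p : X × X => p.1 = p.2)
      (relabel (fun q : (X × X) × (A × R) => ((q.1.2, q.2.2), (q.1.1, q.2.1))) measured)
  trFst (relabel (fun q : X × (X × A × R) => ((q.1, q.2.1), q.2.2)) selected)

/-- The conditional state `ρ_{|Ω} = ρ_{∧Ω} / Tr ρ_{∧Ω}` belonging to a partial state `ρ_{∧Ω}`. -/
def condState {X : Type*} [Fintype X] (ρ : Op X) : Op X := (ρ.trace)⁻¹ • ρ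

/-! ### Min-entropies, with values in the extended reals -/

/-- The extended-real-valued function `-lg` (base two) on `[0, ∞)`, with `-lg 0 = +∞`. -/
def negLg (x : ℝ) : EReal := if x ≤ 0 then ⊤ else ((-Real.logb 2 x : ℝ) : EReal)

/-- The conditional min-entropy
`H_min(X|Y)_ρ = -lg inf {Tr σ_Y | ρ_{XY} ≤ 1_X ⊗ σ_Y, σ_Y ≥ 0}`. -/
def Hmin {X Y : Type*} [DecidableEq X] [Fintype Y] (ρ : Op (X × Y)) : EReal :=
  negLg (sInf {r : ℝ | ∃ σ : Op Y, σ.PosSemidef ∧ ρ ≤ (1 : Op X) ⊗ₖ σ ∧ r = σ.trace.re})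

/-- The entropy of guessing `X` with a fixed measurement `M` of `A`:
`H_min(X|M(A))_ρ = -lg Tr ρ_{∧(M(A) = X)}`. -/
def HminGuess {X A R : Type*} [Fintype X] [DecidableEq X] [Fintype A] [DecidableEq A] [Fintype R]
    (M : X → Op A) (ρ : Op (X × A × R)) : EReal :=
  negLg (partialGuess M ρ).trace.re

/-! ### Subspace coset states -/

/-- Bit strings of length `n`, as a vector space over the field with two elements. -/
abbrev Bits (n : ℕ) := Fin n → ZMod 2

/-- All subspaces of dimension `n / 2` (used for even `n`). -/
def halfSubspaces (n : ℕ) : Set (Submodule (ZMod 2) (Bits n)) :=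
  {a | Module.finrank (ZMod 2) a = n / 2}

/-- The register subspaces of dimension `n / 2`: those spanned by canonical basis vectors. -/
def registerSubspaces (n : ℕ) : Set (Submodule (ZMod 2) (Bits n)) :=
  {a | a ∈ halfSubspaces n ∧
    ∃ S : Set (Fin n), a = Submodule.span (ZMod 2) ((fun i => (Pi.single i 1 : Bits n)) '' S)}

/-- The orthogonal subspace `a^⊥ = {v | u · v = 0 for all u ∈ a}`. -/
def orth {n : ℕ} (a : Submodule (ZMod 2) (Bits n)) : Submodule (ZMod 2) (Bits n) where
  carrier := {v | ∀ u ∈ a, u ⬝ᵥ v = 0}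
  zero_mem' := fun u _ => dotProduct_zero u
  add_mem' := fun {v w} hv hw u hu => by rw [dotProduct_add, hv u hu, hw u hu, add_zero]
  smul_mem' := fun c v hv u hu => by rw [dotProduct_smul, hv u hu, smul_zero]

open Classical in
/-- The coset state `|a_{t,t'}⟩ = |a|^{-1/2} ∑_{u ∈ a} (-1)^{u·t'} |u + t⟩` for `t, t' ∈ Z_2^n`. -/
def cosetVec {n : ℕ} (a : Submodule (ZMod 2) (Bits n)) (t t' : Bits n) : Bits n → ℂ :=
  ((Real.sqrt (Nat.card a) : ℝ) : ℂ)⁻¹ •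
    ∑ u : Bits n with u ∈ a, (-1 : ℂ) ^ (u ⬝ᵥ t').val • (Pi.single (u + t) 1 : Bits n → ℂ)

/-- A choice of coset representatives: for each subspace `a` of dimension `n / 2` of `Z_2^n`
(`n` even) a linear map `t ↦ t_a` such that `t ↦ t_a + a` is an isomorphism
`Z_2^{n/2} ≅ Z_2^n / a`. -/
structure CosetReps (n : ℕ) where
  rep : Submodule (ZMod 2) (Bits n) → Bits (n / 2) →ₗ[ZMod 2] Bits n
  bijective : ∀ a ∈ halfSubspaces n, Function.Bijective (fun t => a.mkQ (rep a t))

/-- The coset state `|a_{t,t'}⟩` for `t, t' ∈ Z_2^{n/2}`, that is, the coset state of the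
representatives `t_a` and `t'_{a^⊥}`. -/
def cosetKet {n : ℕ} (r : CosetReps n) (a : Submodule (ZMod 2) (Bits n)) (t t' : Bits (n / 2)) :
    Bits n → ℂ :=
  cosetVec a (r.rep a t) (r.rep (orth a) t')

/-! ### The state in the leaky monogamy-of-entanglement game -/

section Game

variable {n : ℕ} [DecidableEq (Submodule (ZMod 2) (Bits n))]

/-- Alice's state `ρ_{AA'TT'V} = E_{a,t,t'} [a a t t'] ⊗ |a_{t,t'}⟩⟨a_{t,t'}|`, for uniformly random
`a ∈ A` and `t, t' ∈ Z_2^{n/2}`. -/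
def aliceState (A : Finset (Submodule (ZMod 2) (Bits n))) (r : CosetReps n) :
    Op ((A × A × Bits (n / 2) × Bits (n / 2)) × Bits n) :=
  ((Fintype.card (A × Bits (n / 2) × Bits (n / 2)) : ℕ) : ℂ)⁻¹ •
    ∑ a : A, ∑ t : Bits (n / 2), ∑ t' : Bits (n / 2),
      cstate (a, a, t, t') ⊗ₖ ketbra (cosetKet r a t t')

/-- The state `ρ_{AA'TT'BC} = (id_{AA'TT'} ⊗ Φ)(ρ_{AA'TT'V})` after Bob and Charlie split `V` into
`B` and `C` by the channel `Φ`. -/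
def gameState (A : Finset (Submodule (ZMod 2) (Bits n))) (r : CosetReps n) {B C : Type*}
    (Φ : Op (Bits n) →ₗ[ℂ] Op (B × C)) :
    Op ((A × A × Bits (n / 2) × Bits (n / 2)) × (B × C)) :=
  idTensor _ Φ (aliceState A r)

/-- The state of the game with its registers in the order `T`, `AB`, `A'T'C`. -/
def gameStateBob (A : Finset (Submodule (ZMod 2) (Bits n))) (r : CosetReps n) {B C : Type*}
    (Φ : Op (Bits n) →ₗ[ℂ] Op (B × C)) :
    Op (Bits (n / 2) × (A × B) × (A × Bits (n / 2) × C)) :=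
  relabel (fun p => ((p.2.1.1, p.2.2.1, p.1, p.2.2.2.1), (p.2.1.2, p.2.2.2.2))) (gameState A r Φ)

/-- The marginal on `T'` and `A'TC` of a state with registers `T`, `AB`, `A'T'C`. -/
def charlieMarginal {T A B A' T' C : Type*} [Fintype A] [Fintype B]
    (ρ : Op (T × (A × B) × (A' × T' × C))) : Op (T' × (A' × T × C)) :=
  trFst (relabel
    (fun p : (A × B) × (T' × (A' × T × C)) =>
      (p.2.2.2.1, p.1, (p.2.2.1, p.2.1, p.2.2.2.2))) ρ)

end Game

end CosetMoE

end

open CosetMoE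

/-!
The two entropies telescope: the conditional state is the partial state divided by its trace, so
the sum of the entropies is `-lg (inf Tr σ)`, where `σ` runs through the operators of Charlie's
registers `A'TC` with `ρ_{∧(M(AB)=T)} ≤ 1 ⊗ σ`.  It suffices to find one such `σ` with trace at
most `cos (π / 8) ^ n`; the additive constant of the theorem is not needed.

*Duality.* Since `T'` is classical, the minimal trace of `σ` is the maximal probability that Bob
guesses `t` with `M` and Charlie guesses `t'` with a measurement of `A'TC`
(`exists_posSemidef_ge_of_forall_isPOVM`).  An optimal measurement `P` exists by compactness, and
the optimality condition of first order says that the Hermitian part of `∑ P_{t'} ρ_{t'}`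
dominates every `ρ_{t'}`.

*Reduction to operators.* Through the Choi matrix `J` of the channel, which is positive and has
trace `2 ^ n`, the winning probability becomes an average over `a` of `Tr (Π_a J) / 2 ^ n`, where
`Π_a = ∑ |a_{t,t'}⟩⟨a_{t,t'}| ⊗ M_t ⊗ P_{t'}`; Charlie's measurement `P` may depend on `a` and `t`
(`sum_trace_charlieState_eq`).

*Almost orthogonality.* Coarsening the coset basis of `a` to the projections on the cosets of `a`,
and using that Bob's and Charlie's operators commute with everything on the other registers, gives
`|⟨Π_a ψ, Π_b ψ⟩| ≤ c ‖√Π_a ψ‖ ‖√Π_b ψ‖` with `c ^ 2 = |a ∩ b| / |b|`, the largest squared norm of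
the projection of a state `|b_{s,s'}⟩` to a coset of `a`
(`GuessingFamily.norm_inner_win_win_le`).  The measurements need not be projective.
By the Schur test, the winning probabilities of a family of subspaces add up to at most the largest
row sum of these overlaps (`GuessingFamily.sum_winProb_le`).

*Choice of the family.* Pair up the coordinates and let `θ` choose one coordinate of each pair.  The
`2 ^ (n / 2)` coordinate subspaces obtained have row sums `(1 + 1 / √2) ^ (n / 2)`, which is
`2 ^ (n / 2) * cos (π / 8) ^ n`.  The translates of this family by the permutations of the
coordinates, respectively by all linear automorphisms, cover uniformly the register subspaces,
respectively all subspaces of dimension `n / 2` (`exists_uniform_cover`), so the bound for the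
family is a bound for the average over `A`.
-/

namespace CosetMoE

/-! ### Duality between min-entropy and guessing probability -/

lemma norm_apply_le_of_posSemidef {Y : Type*} [Fintype Y] {P : Op Y} (hP : P.PosSemidef)
    (i j : Y) : ‖P i j‖ ≤ ((P i i).re + (P j j).re) / 2 := by
  classical
  obtain ⟨Q, rfl⟩ := CStarAlgebra.nonneg_iff_eq_star_mul_self.mp hP.nonneg
  have hd : ∀ i, ((star Q * Q) i i).re = ∑ k, ‖Q k i‖ ^ 2 := by
    intro i
    simp only [Matrix.mul_apply, Matrix.star_apply, Complex.re_sum]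
    refine Finset.sum_congr rfl fun k _ => ?_
    rw [RCLike.star_def, Complex.conj_mul', ← Complex.ofReal_pow, Complex.ofReal_re]
  rw [hd, hd, ← Finset.sum_add_distrib, Finset.sum_div, Matrix.mul_apply]
  refine (norm_sum_le _ _).trans (Finset.sum_le_sum fun k _ => ?_)
  rw [norm_mul, Matrix.star_apply, norm_star]
  nlinarith [sq_nonneg (‖Q k i‖ - ‖Q k j‖)]

lemma IsPOVM.norm_apply_le_one {S Y : Type*} [Fintype S] [Fintype Y] [DecidableEq Y]
    {P : S → Op Y} (hP : IsPOVM P) (s : S) (i j : Y) : ‖P s i j‖ ≤ 1 := by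
  have hd : ∀ i, (P s i i).re ≤ 1 := by
    intro i
    have h1 : ∑ s, (P s i i).re = 1 := by
      rw [← Complex.re_sum, ← Matrix.sum_apply, hP.sum_eq_one, Matrix.one_apply_eq, Complex.one_re]
    rw [← h1]
    exact Finset.single_le_sum (f := fun s => (P s i i).re)
      (fun s _ => (Complex.le_def.mp ((hP.posSemidef s).diag_nonneg (i := i))).1) (Finset.mem_univ s)
  linarith [norm_apply_le_of_posSemidef (hP.posSemidef s) i j, hd i, hd j]

lemma isClosed_setOf_posSemidef {Y : Type*} [Fintype Y] : IsClosed {P : Op Y | P.PosSemidef} := by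
  simp only [Matrix.posSemidef_iff_dotProduct_mulVec, Set.ofPred_and, Set.ofPred_forall]
  refine IsClosed.inter ?_ (isClosed_iInter fun x => ?_)
  · exact isClosed_eq (continuous_id.matrix_conjTranspose) continuous_id
  · refine isClosed_le continuous_const ?_
    exact Continuous.dotProduct continuous_const
      (Continuous.matrix_mulVec continuous_id continuous_const)

lemma isCompact_setOf_isPOVM {S Y : Type*} [Fintype S] [Fintype Y] [DecidableEq Y] :
    IsCompact {P : S → Op Y | IsPOVM P} := by
  have hK : IsCompact (Set.univ.pi fun _ : S => (Set.univ.pi fun _ : Y => Set.univ.pi fun _ : Y =>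
      Metric.closedBall (0 : ℂ) 1 : Set (Op Y))) :=
    isCompact_univ_pi fun _ => isCompact_univ_pi fun _ => isCompact_univ_pi fun _ =>
      isCompact_closedBall _ _
  refine hK.of_isClosed_subset ?_ fun P hP s _ i _ j _ => ?_
  · have : {P : S → Op Y | IsPOVM P} =
        (⋂ s, (fun P : S → Op Y => P s) ⁻¹' {P | P.PosSemidef}) ∩ {P | ∑ s, P s = 1} := by
      ext P
      simp only [Set.mem_ofPred_eq, Set.mem_inter_iff, Set.mem_iInter, Set.mem_preimage]
      exact ⟨fun h => ⟨h.1, h.2⟩, fun h => ⟨h.1, h.2⟩⟩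
    rw [this]
    refine IsClosed.inter (isClosed_iInter fun s =>
      IsClosed.preimage (continuous_apply (A := fun _ : S => Op Y) s) isClosed_setOf_posSemidef)
      (isClosed_eq ?_ continuous_const)
    exact continuous_finsetSum _ fun s _ => continuous_apply s
  · rw [mem_closedBall_zero_iff]
    exact IsPOVM.norm_apply_le_one hP s i j

lemma isPOVM_single {S Y : Type*} [Fintype S] [DecidableEq S] [DecidableEq Y] (s : S) :
    IsPOVM (fun s' : S => if s' = s then (1 : Op Y) else 0) := by
  refine ⟨fun s' => ?_, by simp⟩
  split_ifs
  · exact .one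
  · exact .zero

/-- A measurement that maximizes the guessing probability exists, since the measurements form a
compact set. -/
lemma exists_optimal_povm {S Y : Type*} [Fintype S] [Nonempty S] [Fintype Y] [DecidableEq Y]
    (ρ : S → Op Y) : ∃ P, IsPOVM P ∧ ∀ Q, IsPOVM Q →
      (∑ s, (Q s * ρ s).trace).re ≤ (∑ s, (P s * ρ s).trace).re := by
  classical
  obtain ⟨s₀⟩ := ‹Nonempty S›
  obtain ⟨P, hP, hmax⟩ := (isCompact_setOf_isPOVM (S := S) (Y := Y)).exists_isMaxOn
    ⟨_, isPOVM_single s₀⟩ (f := fun P => (∑ s, (P s * ρ s).trace).re) (by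
      refine (Complex.continuous_re.comp ?_).continuousOn
      exact continuous_finsetSum _ fun s _ =>
        ((continuous_apply s).matrix_mul continuous_const).matrix_trace)
  exact ⟨P, hP, fun Q hQ => hmax hQ⟩

/-- A measurement `P` is compressed by `1 - c V`, and what is missing from the identity is given to
the outcome `y`.  For `c → 0` this is the variation that decides whether `P` is optimal. -/
lemma IsPOVM.perturb {S Y : Type*} [Fintype S] [DecidableEq S] [Fintype Y] [DecidableEq Y]
    {P : S → Op Y} (hP : IsPOVM P) (y : S) {V : Op Y} (hV : V.PosSemidef) {ν c : ℝ}
    (hνV : V * V = (ν : ℂ) • V) (hc : 0 ≤ 2 * c - c ^ 2 * ν) :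
    IsPOVM fun s => (1 - (c : ℂ) • V) * P s * (1 - (c : ℂ) • V) +
      if s = y then ((2 * c - c ^ 2 * ν : ℝ) : ℂ) • V else 0 := by
  have hD : (1 - (c : ℂ) • V)ᴴ = 1 - (c : ℂ) • V := by
    simp [hV.1.eq]
  refine ⟨fun s => ?_, ?_⟩
  · refine Matrix.PosSemidef.add ?_ ?_
    · have := (hP.posSemidef s).conjTranspose_mul_mul_same (1 - (c : ℂ) • V)
      rwa [hD] at this
    · split_ifs
      · exact hV.smul (by exact_mod_cast hc)
      · exact .zero
  · rw [Finset.sum_add_distrib, ← Finset.sum_mul, ← Finset.mul_sum, hP.sum_eq_one,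
      Finset.sum_ite_eq' , if_pos (Finset.mem_univ _), mul_one, sub_mul, mul_sub, mul_sub,
      smul_mul_smul_comm, hνV]
    ext i j
    simp only [one_mul, mul_one, Matrix.add_apply, Matrix.sub_apply, Matrix.smul_apply, smul_eq_mul]
    push_cast
    ring

lemma trace_perturb {Y : Type*} [Fintype Y] [DecidableEq Y] (P ρ V : Op Y) (c : ℂ) :
    ((1 - c • V) * P * (1 - c • V) * ρ).trace = (P * ρ).trace
      - c * (V * (P * ρ + ρ * P)).trace + c ^ 2 * (V * P * V * ρ).trace := by
  have h : (P * (V * ρ)).trace = (V * (ρ * P)).trace := by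
    rw [Matrix.trace_mul_comm, mul_assoc]
  simp only [sub_mul, mul_sub, one_mul, mul_one, Matrix.smul_mul, Matrix.mul_smul, smul_smul,
    Matrix.trace_sub, Matrix.trace_smul, mul_add, Matrix.trace_add, smul_eq_mul, h, mul_assoc]
  ring

lemma ketbra_posSemidef {X : Type*} [Finite X] (v : X → ℂ) : (ketbra v).PosSemidef :=
  Matrix.posSemidef_vecMulVec_self_star v

/-- Strong duality for the discrimination of the subnormalized states `ρ s`: if no measurement
guesses `s` with probability more than `p`, then some common upper bound of the `ρ s` has trace at
most `p`.  The bound is the Hermitian part of `∑ s, P s * ρ s` for an optimal measurement `P`. -/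
theorem exists_posSemidef_ge_of_forall_isPOVM {S Y : Type*} [Fintype S] [Nonempty S] [Fintype Y]
    [DecidableEq Y] (ρ : S → Op Y) (hρ : ∀ s, (ρ s).PosSemidef) {p : ℝ}
    (hp : ∀ Q, IsPOVM Q → (∑ s, (Q s * ρ s).trace).re ≤ p) :
    ∃ σ : Op Y, (∀ s, (σ - ρ s).PosSemidef) ∧ σ.trace.re ≤ p := by
  classical
  obtain ⟨P, hP, hmax⟩ := exists_optimal_povm ρ
  set σ : Op Y := (2⁻¹ : ℂ) • ∑ s, (P s * ρ s + ρ s * P s) with hσ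
  have hPH : ∀ s, (P s)ᴴ = P s := fun s => (hP.posSemidef s).1.eq
  have hρH : ∀ s, (ρ s)ᴴ = ρ s := fun s => (hρ s).1.eq
  have hσH : σᴴ = σ := by
    rw [hσ, Matrix.conjTranspose_smul, Matrix.conjTranspose_sum]
    congr 1
    · simp
    · refine Finset.sum_congr rfl fun s _ => ?_
      rw [Matrix.conjTranspose_add, Matrix.conjTranspose_mul, Matrix.conjTranspose_mul, hPH, hρH,
        add_comm]
  refine ⟨σ, fun y => ?_, ?_⟩
  · refine Matrix.PosSemidef.of_dotProduct_mulVec_nonneg ?_ fun v => ?_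
    · exact (show σ.IsHermitian from hσH).sub (hρ y).1
    have hherm : (σ - ρ y).IsHermitian := (show σ.IsHermitian from hσH).sub (hρ y).1
    set V := ketbra v with hVdef
    have hV : V.PosSemidef := ketbra_posSemidef v
    have hquad : star v ⬝ᵥ (σ - ρ y) *ᵥ v = (V * (σ - ρ y)).trace := by
      rw [hVdef, ketbra, Matrix.vecMulVec_mul, Matrix.trace_vecMulVec, dotProduct_comm v,
        Matrix.dotProduct_mulVec]
    set ν : ℝ := ∑ i, ‖v i‖ ^ 2 with hν
    have hν0 : 0 ≤ ν := Finset.sum_nonneg fun i _ => sq_nonneg _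
    have hνV : V * V = (ν : ℂ) • V := by
      rw [hVdef, ketbra, Matrix.vecMulVec_mul_vecMulVec, Matrix.vecMulVec_smul]
      congr 1
      rw [hν]
      simp only [dotProduct, Pi.star_apply, RCLike.star_def, Complex.conj_mul', Complex.ofReal_sum,
        Complex.ofReal_pow]
    set x : ℝ := (V * (ρ y - σ)).trace.re with hx
    set K : ℝ := (∑ s, (V * P s * V * ρ s).trace).re - ν * (V * ρ y).trace.re with hK
    -- optimality against the perturbed measurement, divided by `c`
    have key : ∀ c : ℝ, 0 < c → c * (ν + 1) ≤ 1 → 2 * x + c * K ≤ 0 := by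
      intro c hc hc1
      have h0 : 0 ≤ 2 * c - c ^ 2 * ν := by nlinarith
      have := hmax _ (hP.perturb y hV hνV h0)
      have hexp : ∑ s, (((1 - (c : ℂ) • V) * P s * (1 - (c : ℂ) • V) +
          if s = y then ((2 * c - c ^ 2 * ν : ℝ) : ℂ) • V else 0) * ρ s).trace
          = ∑ s, (P s * ρ s).trace - (2 * c : ℝ) * (V * σ).trace
            + ((c ^ 2 : ℝ) : ℂ) * ∑ s, (V * P s * V * ρ s).trace
            + ((2 * c - c ^ 2 * ν : ℝ) : ℂ) * (V * ρ y).trace := by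
        simp only [add_mul, Matrix.trace_add, trace_perturb, Finset.sum_add_distrib,
          Finset.sum_sub_distrib, ite_mul, zero_mul, apply_ite Matrix.trace, Matrix.trace_zero,
          Finset.sum_ite_eq', Finset.mem_univ, if_true, Matrix.smul_mul, Matrix.trace_smul,
          smul_eq_mul, ← Finset.mul_sum]
        congr 2
        · congr 1
          rw [hσ, Matrix.mul_smul, Matrix.trace_smul, Matrix.mul_sum, Matrix.trace_sum, smul_eq_mul]
          simp only [mul_add, Matrix.trace_add, Finset.sum_add_distrib]
          push_cast
          ring
        · push_cast; rfl
      rw [hexp] at this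
      simp only [Complex.add_re, Complex.sub_re, Complex.re_ofReal_mul] at this
      have hxe : x = (V * ρ y).trace.re - (V * σ).trace.re := by
        rw [hx, mul_sub, Matrix.trace_sub, Complex.sub_re]
      have h2 : c * (2 * x + c * K) ≤ 0 := by
        rw [hxe, hK]; linarith
      exact nonpos_of_mul_nonpos_right h2 hc
    have hx0 : x ≤ 0 := by
      by_contra! hpos
      have hK0 : 0 ≤ |K| := abs_nonneg K
      set c := min (1 / (ν + 1)) (x / (|K| + 1)) with hc
      have hc0 : 0 < c := lt_min (by positivity) (by positivity)
      have h1 : c * (ν + 1) ≤ 1 := by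
        rw [← le_div_iff₀ (by positivity)]; exact min_le_left _ _
      have h2 : c * (|K| + 1) ≤ x := by
        rw [← le_div_iff₀ (by positivity)]; exact min_le_right _ _
      have h3 : -(c * |K|) ≤ c * K := by
        have := neg_abs_le K
        nlinarith
      nlinarith [key c hc0 h1]
    rw [hquad, Complex.le_def]
    constructor
    · have : (V * (σ - ρ y)).trace.re = -x := by
        rw [hx, ← neg_sub σ, mul_neg, Matrix.trace_neg, Complex.neg_re, neg_neg]
      rw [this]; simpa using hx0
    · rw [← hquad]
      exact (hherm.im_star_dotProduct_mulVec_self v).symm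
  · have : σ.trace.re = (∑ s, (P s * ρ s).trace).re := by
      rw [hσ, Matrix.trace_smul, Matrix.trace_sum]
      simp only [Matrix.trace_add, Matrix.trace_mul_comm (ρ _) (P _), ← two_mul, ← Finset.mul_sum,
        smul_eq_mul]
      congr 1
      ring
    rw [this]
    exact hp P hP

/-! ### An almost-orthogonality bound for commuting measurements -/

section Operators

lemma mul_clm_apply {H : Type*} [NormedAddCommGroup H] [InnerProductSpace ℂ H]
    (A B : H →L[ℂ] H) (x : H) : (A * B) x = A (B x) := rfl

lemma apply_comm {H : Type*} [NormedAddCommGroup H] [InnerProductSpace ℂ H]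
    {A B : H →L[ℂ] H} (h : Commute A B) (x : H) : A (B x) = B (A x) := by
  rw [← mul_clm_apply, h.eq, mul_clm_apply]

variable {H : Type*} [NormedAddCommGroup H] [InnerProductSpace ℂ H] [CompleteSpace H]

lemma inner_apply_comm_of_isSelfAdjoint {A : H →L[ℂ] H} (hA : IsSelfAdjoint A) (x y : H) :
    inner ℂ (A x) y = inner ℂ x (A y) := hA.isSymmetric x y

lemma sum_norm_sq_apply_of_sum_mul_self {S : Type*} [Fintype S] {m : S → H →L[ℂ] H}
    (hm : ∀ s, IsSelfAdjoint (m s)) (hsum : ∑ s, m s * m s = 1) (x : H) :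
    ∑ s, ‖m s x‖ ^ 2 = ‖x‖ ^ 2 := by
  have h : ∀ s, ‖m s x‖ ^ 2 = (inner ℂ x ((m s * m s) x)).re := by
    intro s
    rw [mul_clm_apply, ← inner_apply_comm_of_isSelfAdjoint (hm s)]
    exact (inner_self_eq_norm_sq (𝕜 := ℂ) _).symm
  simp only [h, ← Complex.re_sum, ← inner_sum, ← _root_.sum_apply, hsum]
  exact inner_self_eq_norm_sq (𝕜 := ℂ) _

lemma norm_apply_le_of_sum_mul_self {S : Type*} [Fintype S] {m : S → H →L[ℂ] H}
    (hm : ∀ s, IsSelfAdjoint (m s)) (hsum : ∑ s, m s * m s = 1) (s : S) (x : H) :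
    ‖m s x‖ ≤ ‖x‖ := by
  refine le_of_sq_le_sq ?_ (norm_nonneg _)
  rw [← sum_norm_sq_apply_of_sum_mul_self hm hsum x]
  exact Finset.single_le_sum (f := fun s => ‖m s x‖ ^ 2) (fun _ _ => sq_nonneg _)
    (Finset.mem_univ s)

/-- A family, indexed by `Θ`, of measurements on a Hilbert space `H` that is thought of as
`V ⊗ B ⊗ C`.  On `V` acts, for each `α : Θ`, a projective measurement with projections `e α t t'`
and its coarsening `E α t` to the first outcome `t`; the coarsenings of different `α` commute.  On
`B` and `C` act the square roots `m α t` and `p α t t'` of the effects of the guesses for `t`, and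
for `t'` given `t`.  Only the laws that enter the bound are recorded. -/
structure GuessingFamily (Θ S S' H : Type*) [Fintype S] [Fintype S'] [DecidableEq S']
    [NormedAddCommGroup H] [InnerProductSpace ℂ H] [CompleteSpace H] where
  E : Θ → S → H →L[ℂ] H
  e : Θ → S → S' → H →L[ℂ] H
  m : Θ → S → H →L[ℂ] H
  p : Θ → S → S' → H →L[ℂ] H
  E_selfAdjoint : ∀ α t, IsSelfAdjoint (E α t)
  e_selfAdjoint : ∀ α t t', IsSelfAdjoint (e α t t')
  m_selfAdjoint : ∀ α t, IsSelfAdjoint (m α t)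
  p_selfAdjoint : ∀ α t t', IsSelfAdjoint (p α t t')
  E_sum : ∀ α, ∑ t, E α t * E α t = 1
  m_sum : ∀ α, ∑ t, m α t * m α t = 1
  p_sum : ∀ α t, ∑ t', p α t t' * p α t t' = 1
  E_mul_e : ∀ α t t', E α t * e α t t' = e α t t'
  e_mul_e : ∀ α t t' u', e α t t' * e α t u' = if t' = u' then e α t t' else 0
  commute_E_E : ∀ α β t s, Commute (E α t) (E β s)
  commute_E_m : ∀ α β t s, Commute (E α t) (m β s)
  commute_E_p : ∀ α β t s s', Commute (E α t) (p β s s')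
  commute_e_m : ∀ α β t t' s, Commute (e α t t') (m β s)
  commute_e_p : ∀ α β t t' s s', Commute (e α t t') (p β s s')
  commute_m_p : ∀ α β t s s', Commute (m α t) (p β s s')

namespace GuessingFamily

variable {Θ S S' : Type*} [Fintype S] [Fintype S'] [DecidableEq S']
  (X : GuessingFamily Θ S S' H)

/-- The effect of the event that both guesses are correct. -/
def win (α : Θ) : H →L[ℂ] H :=
  ∑ t, ∑ t', X.e α t t' * (X.m α t * X.m α t) * (X.p α t t' * X.p α t t')

/-- The probability, in the state `ψ`, of the event that both guesses are correct. -/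
def winProb (α : Θ) (ψ : H) : ℝ :=
  ∑ t, ∑ t', ‖X.e α t t' (X.m α t (X.p α t t' ψ))‖ ^ 2

lemma winProb_nonneg (α : Θ) (ψ : H) : 0 ≤ X.winProb α ψ :=
  Finset.sum_nonneg fun _ _ => Finset.sum_nonneg fun _ _ => sq_nonneg _

lemma e_e (α : Θ) (t : S) (t' : S') (x : H) : X.e α t t' (X.e α t t' x) = X.e α t t' x := by
  rw [← mul_clm_apply, X.e_mul_e, if_pos rfl]

lemma E_e (α : Θ) (t : S) (t' : S') (x : H) : X.E α t (X.e α t t' x) = X.e α t t' x := by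
  rw [← mul_clm_apply, X.E_mul_e]

lemma inner_win (α : Θ) (ψ : H) : inner ℂ ψ (X.win α ψ) = (X.winProb α ψ : ℂ) := by
  simp only [win, winProb, _root_.sum_apply, inner_sum, Complex.ofReal_sum]
  refine Finset.sum_congr rfl fun t _ => Finset.sum_congr rfl fun t' _ => ?_
  simp only [mul_clm_apply]
  have h : X.e α t t' (X.m α t (X.m α t (X.p α t t' (X.p α t t' ψ)))) =
      X.p α t t' (X.m α t (X.e α t t' (X.e α t t' (X.m α t (X.p α t t' ψ))))) := by
    rw [e_e, apply_comm (X.commute_m_p α α t t t'), apply_comm (X.commute_m_p α α t t t'),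
      apply_comm (X.commute_e_p α α t t' t t'), apply_comm (X.commute_e_m α α t t' t)]
  rw [h, ← inner_apply_comm_of_isSelfAdjoint (X.p_selfAdjoint α t t'),
    ← inner_apply_comm_of_isSelfAdjoint (X.m_selfAdjoint α t),
    ← inner_apply_comm_of_isSelfAdjoint (X.e_selfAdjoint α t t'), inner_self_eq_norm_sq_to_K]
  push_cast
  rfl

lemma norm_sq_sum_e (α : Θ) (t : S) (y : S' → H) :
    ‖∑ t', X.e α t t' (y t')‖ ^ 2 = ∑ t', ‖X.e α t t' (y t')‖ ^ 2 := by
  have h : ∀ t' u', inner ℂ (X.e α t t' (y t')) (X.e α t u' (y u')) =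
      if t' = u' then ((‖X.e α t t' (y t')‖ ^ 2 : ℝ) : ℂ) else 0 := by
    intro t' u'
    by_cases hu : t' = u'
    · subst hu
      rw [if_pos rfl, inner_self_eq_norm_sq_to_K]
      push_cast
      rfl
    · rw [if_neg hu, inner_apply_comm_of_isSelfAdjoint (X.e_selfAdjoint α t t'),
        ← mul_clm_apply, X.e_mul_e, if_neg hu]
      simp
  have h2 : (inner ℂ (∑ t', X.e α t t' (y t')) (∑ t', X.e α t t' (y t'))).re
      = ∑ t', ‖X.e α t t' (y t')‖ ^ 2 := by
    simp only [sum_inner, inner_sum, h, Finset.mem_univ, if_true,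
      Complex.re_sum, Finset.sum_ite_eq', Complex.ofReal_re]
  rw [← h2]
  exact (inner_self_eq_norm_sq (𝕜 := ℂ) _).symm

/-- The cross terms of two winning effects are bounded by the overlap of the coarsened measurement
of the first with the projections of the second.  The guess for `t` is resolved by the coarsening
`E α t`, the guess for `t'` by the projections `e β s s'`. -/
lemma norm_inner_win_win_le (α β : Θ) {c : ℝ} (hc0 : 0 ≤ c)
    (hc : ∀ t s s' x, ‖X.E α t (X.e β s s' x)‖ ≤ c * ‖x‖) (ψ : H) :
    ‖inner ℂ (X.win α ψ) (X.win β ψ)‖ ≤ c * (√(X.winProb α ψ) * √(X.winProb β ψ)) := by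
  set f : S → H := fun t => ∑ t', X.e α t t' (X.m α t (X.p α t t' (X.p α t t' ψ))) with hf
  set g : S → S' → H := fun s s' => X.e β s s' (X.m β s (X.m β s (X.p β s s' ψ))) with hg
  have hwα : X.win α ψ = ∑ t, X.E α t (X.m α t (f t)) := by
    simp only [win, hf, map_sum, _root_.sum_apply, mul_clm_apply]
    refine Finset.sum_congr rfl fun t _ => Finset.sum_congr rfl fun t' _ => ?_
    rw [apply_comm (X.commute_e_m α α t t' t).symm, E_e]
  have hwβ : X.win β ψ = ∑ s, ∑ s', X.e β s s' (X.p β s s' (g s s')) := by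
    simp only [win, hg, _root_.sum_apply, mul_clm_apply]
    refine Finset.sum_congr rfl fun s _ => Finset.sum_congr rfl fun s' _ => ?_
    rw [apply_comm (X.commute_e_p β β s s' s s').symm, e_e,
      apply_comm (X.commute_m_p β β s s s'), apply_comm (X.commute_m_p β β s s s')]
  have hfnorm : ∑ t, ‖f t‖ ^ 2 ≤ X.winProb α ψ := by
    refine Finset.sum_le_sum fun t _ => ?_
    rw [hf, norm_sq_sum_e]
    refine Finset.sum_le_sum fun t' _ => ?_
    rw [apply_comm (X.commute_m_p α α t t t'), apply_comm (X.commute_e_p α α t t' t t')]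
    gcongr
    exact norm_apply_le_of_sum_mul_self (X.p_selfAdjoint α t) (X.p_sum α t) t' _
  have hgnorm : ∑ s, ∑ s', ‖g s s'‖ ^ 2 ≤ X.winProb β ψ := by
    refine Finset.sum_le_sum fun s _ => Finset.sum_le_sum fun s' _ => ?_
    rw [hg]
    dsimp only
    rw [apply_comm (X.commute_e_m β β s s' s)]
    gcongr
    exact norm_apply_le_of_sum_mul_self (X.m_selfAdjoint β) (X.m_sum β) s _
  have hterm : ∀ t s s', inner ℂ (X.E α t (X.m α t (f t))) (X.e β s s' (X.p β s s' (g s s'))) =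
      inner ℂ (X.p β s s' (X.E β s (f t))) (X.E α t (X.e β s s' (X.m α t (g s s')))) := by
    intro t s s'
    generalize g s s' = y
    generalize f t = z
    rw [inner_apply_comm_of_isSelfAdjoint (X.E_selfAdjoint α t),
      inner_apply_comm_of_isSelfAdjoint (X.m_selfAdjoint α t),
      inner_apply_comm_of_isSelfAdjoint (X.p_selfAdjoint β s s'),
      inner_apply_comm_of_isSelfAdjoint (X.E_selfAdjoint β s)]
    congr 1
    rw [← apply_comm (X.commute_E_p α β t s s'), ← apply_comm (X.commute_e_p β β s s' s s'),
      apply_comm (X.commute_E_E β α s t), E_e, ← apply_comm (X.commute_E_m α α t t),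
      ← apply_comm (X.commute_e_m β α s s' t), apply_comm (X.commute_m_p α β t s s')]
  rw [hwα, hwβ]
  have hexp : inner ℂ (∑ t, X.E α t (X.m α t (f t))) (∑ s, ∑ s', X.e β s s' (X.p β s s' (g s s')))
      = ∑ t, ∑ s, ∑ s', inner ℂ (X.p β s s' (X.E β s (f t)))
        (X.E α t (X.e β s s' (X.m α t (g s s')))) := by
    rw [sum_inner]
    refine Finset.sum_congr rfl fun t _ => ?_
    rw [inner_sum]
    refine Finset.sum_congr rfl fun s _ => ?_
    rw [inner_sum]
    exact Finset.sum_congr rfl fun s' _ => hterm t s s'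
  rw [hexp]
  -- Cauchy–Schwarz over all triples `(t, s, s')`
  have hA : ∑ x : S × S × S', ‖X.p β x.2.1 x.2.2 (X.E β x.2.1 (f x.1))‖ ^ 2 ≤ X.winProb α ψ := by
    rw [Fintype.sum_prod_type]
    refine le_trans (le_of_eq ?_) hfnorm
    refine Finset.sum_congr rfl fun t _ => ?_
    rw [Fintype.sum_prod_type]
    simp only [sum_norm_sq_apply_of_sum_mul_self (X.p_selfAdjoint β _) (X.p_sum β _)]
    exact sum_norm_sq_apply_of_sum_mul_self (X.E_selfAdjoint β) (X.E_sum β) _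
  have hB : ∑ x : S × S × S', ‖X.m α x.1 (g x.2.1 x.2.2)‖ ^ 2 ≤ X.winProb β ψ := by
    rw [Fintype.sum_prod_type_right]
    simp only [sum_norm_sq_apply_of_sum_mul_self (X.m_selfAdjoint α) (X.m_sum α)]
    rw [Fintype.sum_prod_type]
    exact hgnorm
  calc _ ≤ ∑ x : S × S × S', ‖X.p β x.2.1 x.2.2 (X.E β x.2.1 (f x.1))‖ *
        (c * ‖X.m α x.1 (g x.2.1 x.2.2)‖) := by
        simp only [Fintype.sum_prod_type]
        refine (norm_sum_le _ _).trans (Finset.sum_le_sum fun t _ => ?_)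
        refine (norm_sum_le _ _).trans (Finset.sum_le_sum fun s _ => ?_)
        refine (norm_sum_le _ _).trans (Finset.sum_le_sum fun s' _ => ?_)
        refine (norm_inner_le_norm _ _).trans ?_
        gcongr
        exact hc _ _ _ _
    _ = c * ∑ x : S × S × S', ‖X.p β x.2.1 x.2.2 (X.E β x.2.1 (f x.1))‖ *
        ‖X.m α x.1 (g x.2.1 x.2.2)‖ := by
        rw [Finset.mul_sum]
        exact Finset.sum_congr rfl fun x _ => by ring
    _ ≤ c * (√(X.winProb α ψ) * √(X.winProb β ψ)) := by
        gcongr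
        refine (Real.sum_mul_le_sqrt_mul_sqrt _ _ _).trans ?_
        gcongr

/-- If the pairwise overlaps `c α β` have row sums at most `R`, then the winning probabilities of
the family add up to at most `R`. -/
theorem sum_winProb_le [Fintype Θ] [Nonempty Θ] {c : Θ → Θ → ℝ} (hc0 : ∀ α β, 0 ≤ c α β)
    (hsymm : ∀ α β, c α β = c β α)
    (hc : ∀ α β t s s' x, ‖X.E α t (X.e β s s' x)‖ ≤ c α β * ‖x‖)
    {R : ℝ} (hR : ∀ α, ∑ β, c α β ≤ R) (ψ : H) :
    ∑ α, X.winProb α ψ ≤ R * ‖ψ‖ ^ 2 := by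
  set x := ∑ α, X.winProb α ψ with hx
  have hx0 : 0 ≤ x := Finset.sum_nonneg fun α _ => X.winProb_nonneg α ψ
  set w := ∑ α, X.win α ψ with hw
  have h1 : x ≤ ‖ψ‖ * ‖w‖ := by
    have : inner ℂ ψ w = (x : ℂ) := by
      rw [hw, inner_sum, hx, Complex.ofReal_sum]
      exact Finset.sum_congr rfl fun α _ => X.inner_win α ψ
    have h := norm_inner_le_norm (𝕜 := ℂ) ψ w
    rwa [this, Complex.norm_real, Real.norm_of_nonneg hx0] at h
  have h2 : ‖w‖ ^ 2 ≤ R * x := by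
    have : ‖w‖ ^ 2 = ‖inner ℂ w w‖ := by
      rw [inner_self_eq_norm_sq_to_K]; simp
    rw [this, hw, sum_inner]
    simp only [inner_sum]
    calc _ ≤ ∑ α, ∑ β, c α β * ((X.winProb α ψ + X.winProb β ψ) / 2) := by
          refine (norm_sum_le _ _).trans (Finset.sum_le_sum fun α _ => ?_)
          refine (norm_sum_le _ _).trans (Finset.sum_le_sum fun β _ => ?_)
          refine (X.norm_inner_win_win_le α β (hc0 α β) (hc α β) ψ).trans ?_
          refine mul_le_mul_of_nonneg_left ?_ (hc0 α β)
          have ha := Real.sq_sqrt (X.winProb_nonneg α ψ)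
          have hb := Real.sq_sqrt (X.winProb_nonneg β ψ)
          nlinarith [sq_nonneg (√(X.winProb α ψ) - √(X.winProb β ψ))]
      _ = (∑ α, ∑ β, c α β * X.winProb α ψ + ∑ α, ∑ β, c α β * X.winProb β ψ) / 2 := by
          rw [← Finset.sum_add_distrib, Finset.sum_div]
          refine Finset.sum_congr rfl fun α _ => ?_
          rw [← Finset.sum_add_distrib, Finset.sum_div]
          exact Finset.sum_congr rfl fun β _ => by ring
      _ = ∑ α, (∑ β, c α β) * X.winProb α ψ := by
          have : ∑ α, ∑ β, c α β * X.winProb β ψ = ∑ α, ∑ β, c α β * X.winProb α ψ := by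
            rw [Finset.sum_comm]
            exact Finset.sum_congr rfl fun α _ => Finset.sum_congr rfl fun β _ => by
              rw [hsymm]
          rw [this]
          simp only [Finset.sum_mul]
          ring
      _ ≤ R * x := by
          rw [hx, Finset.mul_sum]
          exact Finset.sum_le_sum fun α _ =>
            mul_le_mul_of_nonneg_right (hR α) (X.winProb_nonneg α ψ)
  -- `x ^ 2 ≤ ‖ψ‖ ^ 2 * ‖w‖ ^ 2 ≤ ‖ψ‖ ^ 2 * R * x`, and one factor `x` cancels
  have h3 : x * x ≤ (R * ‖ψ‖ ^ 2) * x := by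
    calc x * x ≤ (‖ψ‖ * ‖w‖) * (‖ψ‖ * ‖w‖) := mul_self_le_mul_self hx0 h1
      _ = ‖ψ‖ ^ 2 * ‖w‖ ^ 2 := by ring
      _ ≤ ‖ψ‖ ^ 2 * (R * x) := by gcongr
      _ = _ := by ring
  rcases hx0.eq_or_lt with h | h
  · rw [← h]
    obtain ⟨α⟩ := ‹Nonempty Θ›
    have : 0 ≤ R := (Finset.sum_nonneg fun β _ => hc0 α β).trans (hR α)
    positivity
  · exact le_of_mul_le_mul_right h3 h

end GuessingFamily
end Operators

/-! ### Coset states -/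

section Coset

variable {n : ℕ}

/-- The nontrivial character `z ↦ (-1)^z` of `ZMod 2`. -/
def sgn (z : ZMod 2) : ℂ := (-1) ^ z.val

lemma sgn_add (z w : ZMod 2) : sgn (z + w) = sgn z * sgn w := by
  rw [sgn, sgn, sgn, ← pow_add, ZMod.val_add, ← neg_one_pow_eq_pow_mod_two]

lemma star_sgn (z : ZMod 2) : star (sgn z) = sgn z := by simp [sgn]

lemma norm_sgn (z : ZMod 2) : ‖sgn z‖ = 1 := by simp [sgn]

lemma bits_sub_eq_add (v w : Bits n) : v - w = v + w :=
  funext fun _ => CharTwo.sub_eq_add _ _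

open Classical in
lemma cosetVec_apply (a : Submodule (ZMod 2) (Bits n)) (t t' x : Bits n) :
    cosetVec a t t' x =
      if x - t ∈ a then ((Real.sqrt (Nat.card a) : ℝ) : ℂ)⁻¹ * sgn ((x - t) ⬝ᵥ t') else 0 := by
  rw [cosetVec, Pi.smul_apply, Finset.sum_apply, smul_eq_mul]
  have h : ∀ u : Bits n, ((-1 : ℂ) ^ (u ⬝ᵥ t').val • (Pi.single (u + t) 1 : Bits n → ℂ)) x =
      if u = x - t then sgn (u ⬝ᵥ t') else 0 := by
    intro u
    rw [Pi.smul_apply, Pi.single_apply, smul_eq_mul, mul_ite, mul_one, mul_zero, sgn]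
    exact if_congr (by rw [eq_sub_iff_add_eq, eq_comm]) rfl rfl
  simp only [h, Finset.sum_ite_eq', Finset.mem_filter, Finset.mem_univ, true_and, mul_ite, mul_zero]

lemma star_cosetVec (a : Submodule (ZMod 2) (Bits n)) (t t' : Bits n) :
    star (cosetVec a t t') = cosetVec a t t' := by
  classical
  ext x
  rw [Pi.star_apply, cosetVec_apply]
  split_ifs
  · rw [star_mul', star_sgn, star_inv₀, RCLike.star_def, Complex.conj_ofReal]
  · exact star_zero _

lemma sqrt_card_inv_mul_self (a : Submodule (ZMod 2) (Bits n)) :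
    ((Real.sqrt (Nat.card a) : ℝ) : ℂ)⁻¹ * ((Real.sqrt (Nat.card a) : ℝ) : ℂ)⁻¹ =
      (Nat.card a : ℂ)⁻¹ := by
  rw [← mul_inv, ← Complex.ofReal_mul, Real.mul_self_sqrt (Nat.cast_nonneg _),
    Complex.ofReal_natCast]

open Classical in
/-- A sum over the coset `t + a`, as a sum over `a`. -/
lemma sum_ite_sub_mem (a : Submodule (ZMod 2) (Bits n)) [Fintype a] (t : Bits n) (f : Bits n → ℂ) :
    ∑ x, (if x - t ∈ a then f (x - t) else 0) = ∑ u : a, f u := by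
  have h := Equiv.sum_comp (Equiv.subRight t) (fun u => if u ∈ a then f u else 0)
  simp only [Equiv.subRight_apply] at h
  rw [h, ← Finset.sum_filter]
  exact Finset.sum_subtype _ (by simp) _

lemma sum_sgn_dotProduct_eq_zero (a : Submodule (ZMod 2) (Bits n)) [Fintype a] {d : Bits n}
    (hd : d ∉ orth a) :
    ∑ u : a, sgn ((u : Bits n) ⬝ᵥ d) = 0 := by
  have : ∃ u ∈ a, u ⬝ᵥ d ≠ 0 := by
    by_contra! h
    exact hd h
  obtain ⟨u₀, hu₀, hne⟩ := this
  -- translation by `u₀` flips every sign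
  have hs : sgn (u₀ ⬝ᵥ d) = -1 := by
    have : u₀ ⬝ᵥ d = 1 := by
      generalize u₀ ⬝ᵥ d = z at hne ⊢
      revert z; decide
    rw [this]; simp [sgn, ZMod.val_one]
  have h := Equiv.sum_comp (Equiv.addRight (⟨u₀, hu₀⟩ : a)) fun u : a => sgn ((u : Bits n) ⬝ᵥ d)
  simp only [Equiv.coe_addRight, Submodule.coe_add, add_dotProduct, sgn_add, hs, mul_neg, mul_one,
    Finset.sum_neg_distrib] at h
  linear_combination (-1 / 2 : ℂ) * h

lemma cosetVec_dotProduct (a : Submodule (ZMod 2) (Bits n)) [Fintype a] (t t' u' : Bits n) :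
    star (cosetVec a t t') ⬝ᵥ cosetVec a t u' =
      (Nat.card a : ℂ)⁻¹ * ∑ u : a, sgn ((u : Bits n) ⬝ᵥ (t' + u')) := by
  classical
  rw [star_cosetVec, ← sum_ite_sub_mem a t fun u => sgn (u ⬝ᵥ (t' + u')), dotProduct, Finset.mul_sum]
  refine Finset.sum_congr rfl fun x _ => ?_
  rw [cosetVec_apply, cosetVec_apply]
  split_ifs
  · rw [dotProduct_add, sgn_add, ← sqrt_card_inv_mul_self]; ring
  · simp

lemma finrank_orth (a : Submodule (ZMod 2) (Bits n)) :
    Module.finrank (ZMod 2) (orth a) = n - Module.finrank (ZMod 2) a := by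
  set D : LinearMap.BilinForm (ZMod 2) (Bits n) := dotProductBilin (ZMod 2) (ZMod 2) with hD
  have happ : ∀ u v, D u v = u ⬝ᵥ v := fun u v => rfl
  have hnd : D.Nondegenerate := by
    refine ⟨fun u h => ?_, fun u h => ?_⟩
    · exact dotProduct_eq_zero _ fun v => by rw [← happ, h]
    · exact dotProduct_eq_zero _ fun v => by rw [dotProduct_comm, ← happ, h]
  have h := LinearMap.BilinForm.finrank_orthogonal hnd a
  rw [Module.finrank_fin_fun] at h
  rw [← h]
  rfl

lemma orth_mem_halfSubspaces (hn : Even n) {a : Submodule (ZMod 2) (Bits n)}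
    (ha : a ∈ halfSubspaces n) : orth a ∈ halfSubspaces n := by
  have h : Module.finrank (ZMod 2) a = n / 2 := ha
  change Module.finrank (ZMod 2) (orth a) = n / 2
  rw [finrank_orth, h]
  obtain ⟨k, rfl⟩ := hn
  omega

lemma CosetReps.eq_of_sub_mem (r : CosetReps n) {a : Submodule (ZMod 2) (Bits n)}
    (ha : a ∈ halfSubspaces n) {t s : Bits (n / 2)} (h : r.rep a t - r.rep a s ∈ a) : t = s :=
  (r.bijective a ha).1 ((Submodule.Quotient.eq a).mpr h)

/-- For a fixed coset the states `|a_{t,t'}⟩` are orthonormal in `t'`. -/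
lemma cosetKet_dotProduct (hn : Even n) (r : CosetReps n) {a : Submodule (ZMod 2) (Bits n)}
    (ha : a ∈ halfSubspaces n) (t t' u' : Bits (n / 2)) :
    star (cosetKet r a t t') ⬝ᵥ cosetKet r a t u' = if t' = u' then 1 else 0 := by
  have := Fintype.ofFinite a
  rw [cosetKet, cosetKet, cosetVec_dotProduct]
  split_ifs with h
  · subst h
    simp only [← bits_sub_eq_add, sub_self, dotProduct_zero]
    simp [sgn]
  · rw [sum_sgn_dotProduct_eq_zero, mul_zero]
    intro hmem
    rw [← bits_sub_eq_add] at hmem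
    exact h (r.eq_of_sub_mem (orth_mem_halfSubspaces hn ha) hmem)

/-- The diagonal projection onto the basis vectors in the coset `t_a + a`. -/
noncomputable def cosetProj (r : CosetReps n) (a : Submodule (ZMod 2) (Bits n))
    (t : Bits (n / 2)) : Op (Bits n) :=
  open Classical in Matrix.diagonal fun x => if x - r.rep a t ∈ a then 1 else 0

lemma sum_cosetProj_mul_self (r : CosetReps n) {a : Submodule (ZMod 2) (Bits n)}
    (ha : a ∈ halfSubspaces n) : ∑ t, cosetProj r a t * cosetProj r a t = 1 := by
  classical
  have h : ∀ t, cosetProj r a t * cosetProj r a t = cosetProj r a t := by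
    intro t
    rw [cosetProj, Matrix.diagonal_mul_diagonal]
    congr 1; ext x; split_ifs <;> simp
  simp only [h]
  ext x y
  rw [Matrix.sum_apply]
  by_cases hxy : x = y
  · subst hxy
    obtain ⟨t, ht⟩ := (r.bijective a ha).2 (a.mkQ x)
    have hmem : ∀ s, x - r.rep a s ∈ a ↔ s = t := by
      intro s
      have ht' : x - r.rep a t ∈ a := (Submodule.Quotient.eq a).mp ht.symm
      refine ⟨fun hs => r.eq_of_sub_mem ha ?_, fun h => h ▸ ht'⟩
      have := a.sub_mem ht' hs
      rwa [sub_sub_sub_cancel_left] at this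
    simp [cosetProj, hmem]
  · simp [cosetProj, hxy]

lemma cosetProj_isHermitian (r : CosetReps n) (a : Submodule (ZMod 2) (Bits n))
    (t : Bits (n / 2)) : (cosetProj r a t).IsHermitian := by
  classical
  rw [cosetProj, Matrix.isHermitian_diagonal_iff]
  intro x
  split_ifs <;> simp [IsSelfAdjoint]

lemma cosetProj_commute (r : CosetReps n) (a b : Submodule (ZMod 2) (Bits n))
    (t s : Bits (n / 2)) : Commute (cosetProj r a t) (cosetProj r b s) :=
  Matrix.commute_diagonal _ _

lemma cosetProj_mulVec_cosetKet (r : CosetReps n) (a : Submodule (ZMod 2) (Bits n))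
    (t t' : Bits (n / 2)) : cosetProj r a t *ᵥ cosetKet r a t t' = cosetKet r a t t' := by
  classical
  ext x
  rw [cosetProj, Matrix.mulVec_diagonal, cosetKet, cosetVec_apply]
  split_ifs <;> simp

lemma card_filter_coset_inter_le (a b : Submodule (ZMod 2) (Bits n)) (t s : Bits n)
    [DecidablePred fun x => x - t ∈ a ∧ x - s ∈ b] :
    (Finset.univ.filter fun x => x - t ∈ a ∧ x - s ∈ b).card ≤ Nat.card ↥(a ⊓ b) := by
  classical
  rcases (Finset.univ.filter fun x => x - t ∈ a ∧ x - s ∈ b).eq_empty_or_nonempty with h | ⟨x₀, h⟩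
  · rw [h]; simp
  · simp only [Finset.mem_filter, Finset.mem_univ, true_and] at h
    rw [Nat.card_eq_fintype_card, Fintype.card_subtype]
    refine Finset.card_le_card_of_injOn (fun x => x - x₀) (fun x hx => ?_)
      fun x _ y _ hxy => sub_left_injective hxy
    simp only [Finset.coe_filter, Finset.mem_univ, true_and, Set.mem_ofPred_eq] at hx ⊢
    have h1 := a.sub_mem hx.1 h.1
    have h2 := b.sub_mem hx.2 h.2
    rw [sub_sub_sub_cancel_right] at h1 h2
    exact ⟨h1, h2⟩

/-- The entries of `|b_{s,s'}⟩` have modulus `|b|^{-1/2}` on the coset of `b`, which meets a coset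
of `a` in at most `|a ∩ b|` points. -/
lemma sum_norm_sq_cosetProj_mulVec_le (r : CosetReps n) (a b : Submodule (ZMod 2) (Bits n))
    (t s s' : Bits (n / 2)) :
    ∑ x, ‖(cosetProj r a t *ᵥ cosetKet r b s s') x‖ ^ 2 ≤
      (Nat.card ↥(a ⊓ b) : ℝ) / Nat.card b := by
  classical
  have h : ∀ x, ‖(cosetProj r a t *ᵥ cosetKet r b s s') x‖ ^ 2 =
      if x - r.rep a t ∈ a ∧ x - r.rep b s ∈ b then (Nat.card b : ℝ)⁻¹ else 0 := by
    intro x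
    rw [cosetProj, Matrix.mulVec_diagonal, cosetKet, cosetVec_apply]
    by_cases h1 : x - r.rep a t ∈ a <;> by_cases h2 : x - r.rep b s ∈ b <;>
      simp [h1, h2, norm_sgn]
  simp only [h]
  rw [← Finset.sum_filter, Finset.sum_const, nsmul_eq_mul, div_eq_mul_inv]
  gcongr
  exact card_filter_coset_inter_le a b _ _

lemma norm_sq_vecMulVec_kronecker_one_apply_le {X K : Type*} [Fintype X] [DecidableEq X]
    [Fintype K] [DecidableEq K] (w v : X → ℂ) (y : EuclideanSpace ℂ (X × K)) :
    ‖Matrix.toEuclideanCLM (𝕜 := ℂ) (Matrix.vecMulVec w (star v) ⊗ₖ (1 : Op K)) y‖ ^ 2 ≤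
      (∑ x, ‖w x‖ ^ 2) * (∑ x, ‖v x‖ ^ 2) * ‖y‖ ^ 2 := by
  have h : ∀ x k, Matrix.toEuclideanCLM (𝕜 := ℂ) (Matrix.vecMulVec w (star v) ⊗ₖ (1 : Op K)) y (x, k)
      = w x * ∑ x', star (v x') * y (x', k) := by
    intro x k
    rw [Matrix.ofLp_toEuclideanCLM, Matrix.mulVec, dotProduct, Fintype.sum_prod_type, Finset.mul_sum]
    refine Finset.sum_congr rfl fun x' _ => ?_
    simp [Matrix.kroneckerMap_apply, Matrix.vecMulVec_apply, Matrix.one_apply, mul_assoc]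
  rw [EuclideanSpace.norm_sq_eq, EuclideanSpace.norm_sq_eq, Fintype.sum_prod_type,
    Fintype.sum_prod_type_right]
  simp only [h, norm_mul, mul_pow, ← Finset.mul_sum]
  rw [← Finset.sum_mul, mul_assoc]
  gcongr
  rw [Finset.mul_sum]
  refine Finset.sum_le_sum fun k _ => ?_
  refine le_trans ?_ (Finset.sum_mul_sq_le_sq_mul_sq _ _ _)
  gcongr
  refine (norm_sum_le _ _).trans (le_of_eq ?_)
  simp

end Coset

/-! ### The winning probability for a family of subspaces with small overlaps -/

section Family

lemma commute_kronecker {X Y : Type*} [Fintype X] [Fintype Y] {P Q : Op X} {P' Q' : Op Y}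
    (h : Commute P Q) (h' : Commute P' Q') : Commute (P ⊗ₖ P') (Q ⊗ₖ Q') := by
  rw [Commute, SemiconjBy, ← Matrix.mul_kronecker_mul, ← Matrix.mul_kronecker_mul, h.eq, h'.eq]

lemma isSelfAdjoint_kronecker {X Y : Type*} {P : Op X} {Q : Op Y}
    (h : IsSelfAdjoint P) (h' : IsSelfAdjoint Q) : IsSelfAdjoint (P ⊗ₖ Q) := by
  rw [IsSelfAdjoint, Matrix.star_eq_conjTranspose, Matrix.conjTranspose_kronecker,
    ← Matrix.star_eq_conjTranspose, ← Matrix.star_eq_conjTranspose, h.star_eq, h'.star_eq]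

lemma IsPOVM.sum_sqrt_mul_sqrt {S X : Type*} [Fintype S] [Fintype X] [DecidableEq X]
    {P : S → Op X} (hP : IsPOVM P) : ∑ s, CFC.sqrt (P s) * CFC.sqrt (P s) = 1 := by
  rw [← hP.sum_eq_one]
  exact Finset.sum_congr rfl fun s _ => CFC.sqrt_mul_sqrt_self _ (hP.posSemidef s).nonneg

lemma sum_kronecker {S X Y : Type*} [Fintype S] (P : S → Op X) (Q : Op Y) :
    ∑ s, P s ⊗ₖ Q = (∑ s, P s) ⊗ₖ Q := by
  ext i j
  simp [Matrix.sum_apply, Finset.sum_mul]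

lemma kronecker_sum {S X Y : Type*} [Fintype S] (P : Op X) (Q : S → Op Y) :
    ∑ s, P ⊗ₖ Q s = P ⊗ₖ (∑ s, Q s) := by
  ext i j
  simp [Matrix.sum_apply, Finset.mul_sum]

lemma isSelfAdjoint_ketbra {X : Type*} (v : X → ℂ) : IsSelfAdjoint (ketbra v) := by
  rw [IsSelfAdjoint, Matrix.star_eq_conjTranspose, ketbra, Matrix.conjTranspose_vecMulVec,
    star_star]

variable {n : ℕ} {Θ B C : Type*} [Fintype B] [DecidableEq B] [Fintype C] [DecidableEq C]

/-- The measurements of the game for the subspaces `a θ`, as operators on `V ⊗ B ⊗ C`. -/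
noncomputable def gameFamily (hn : Even n) (r : CosetReps n)
    (a : Θ → Submodule (ZMod 2) (Bits n)) (ha : ∀ θ, a θ ∈ halfSubspaces n)
    (M : Θ → Bits (n / 2) → Op B) (hM : ∀ θ, IsPOVM (M θ))
    (P : Θ → Bits (n / 2) → Bits (n / 2) → Op C) (hP : ∀ θ t, IsPOVM (P θ t)) :
    GuessingFamily Θ (Bits (n / 2)) (Bits (n / 2)) (EuclideanSpace ℂ (Bits n × (B × C))) where
  E θ t := Matrix.toEuclideanCLM (𝕜 := ℂ) (cosetProj r (a θ) t ⊗ₖ (1 : Op (B × C)))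
  e θ t t' := Matrix.toEuclideanCLM (𝕜 := ℂ) (ketbra (cosetKet r (a θ) t t') ⊗ₖ (1 : Op (B × C)))
  m θ t := Matrix.toEuclideanCLM (𝕜 := ℂ) ((1 : Op (Bits n)) ⊗ₖ (CFC.sqrt (M θ t) ⊗ₖ (1 : Op C)))
  p θ t t' := Matrix.toEuclideanCLM (𝕜 := ℂ)
    ((1 : Op (Bits n)) ⊗ₖ ((1 : Op B) ⊗ₖ CFC.sqrt (P θ t t')))
  E_selfAdjoint θ t :=
    (isSelfAdjoint_kronecker (cosetProj_isHermitian r (a θ) t) (.one _)).map _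
  e_selfAdjoint θ t t' :=
    (isSelfAdjoint_kronecker (isSelfAdjoint_ketbra _) (.one _)).map _
  m_selfAdjoint θ t := (isSelfAdjoint_kronecker (.one _)
    (isSelfAdjoint_kronecker (CFC.sqrt_nonneg _).isSelfAdjoint (.one _))).map _
  p_selfAdjoint θ t t' := (isSelfAdjoint_kronecker (.one _)
    (isSelfAdjoint_kronecker (.one _) (CFC.sqrt_nonneg _).isSelfAdjoint)).map _
  E_sum θ := by
    simp only [← map_mul, ← map_sum, ← Matrix.mul_kronecker_mul, mul_one, sum_kronecker,
      sum_cosetProj_mul_self r (ha θ), Matrix.one_kronecker_one, map_one]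
  m_sum θ := by
    simp only [← map_mul, ← map_sum, ← Matrix.mul_kronecker_mul, mul_one, sum_kronecker,
      kronecker_sum, (hM θ).sum_sqrt_mul_sqrt, Matrix.one_kronecker_one, map_one]
  p_sum θ t := by
    simp only [← map_mul, ← map_sum, ← Matrix.mul_kronecker_mul, mul_one,
      kronecker_sum, (hP θ t).sum_sqrt_mul_sqrt, Matrix.one_kronecker_one, map_one]
  E_mul_e θ t t' := by
    rw [← map_mul, ← Matrix.mul_kronecker_mul, mul_one, ketbra, Matrix.mul_vecMulVec,
      cosetProj_mulVec_cosetKet]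
  e_mul_e θ t t' u' := by
    rw [← map_mul, ← Matrix.mul_kronecker_mul, mul_one, ketbra, ketbra,
      Matrix.vecMulVec_mul_vecMulVec, cosetKet_dotProduct hn r (ha θ)]
    split_ifs with h
    · rw [one_smul, h]
    · rw [zero_smul, Matrix.vecMulVec_zero, Matrix.zero_kronecker, map_zero]
  commute_E_E α β t s := (commute_kronecker (cosetProj_commute r _ _ _ _) (.one_left _)).map _
  commute_E_m α β t s := (commute_kronecker (.one_right _) (.one_left _)).map _
  commute_E_p α β t s s' := (commute_kronecker (.one_right _) (.one_left _)).map _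
  commute_e_m α β t t' s := (commute_kronecker (.one_right _) (.one_left _)).map _
  commute_e_p α β t t' s s' := (commute_kronecker (.one_right _) (.one_left _)).map _
  commute_m_p α β t s s' := (commute_kronecker (.one_right _)
    (commute_kronecker (.one_right _) (.one_left _))).map _

/-- The effect of the event that both Bob and Charlie guess correctly in the game for `a`. -/
noncomputable def winEffect (r : CosetReps n) (a : Submodule (ZMod 2) (Bits n))
    (M : Bits (n / 2) → Op B) (P : Bits (n / 2) → Bits (n / 2) → Op C) : Op (Bits n × (B × C)) :=
  ∑ t, ∑ t', ketbra (cosetKet r a t t') ⊗ₖ (M t ⊗ₖ P t t')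

lemma gameFamily_win (hn : Even n) (r : CosetReps n)
    (a : Θ → Submodule (ZMod 2) (Bits n)) (ha : ∀ θ, a θ ∈ halfSubspaces n)
    (M : Θ → Bits (n / 2) → Op B) (hM : ∀ θ, IsPOVM (M θ))
    (P : Θ → Bits (n / 2) → Bits (n / 2) → Op C) (hP : ∀ θ t, IsPOVM (P θ t)) (θ : Θ) :
    (gameFamily hn r a ha M hM P hP).win θ =
      Matrix.toEuclideanCLM (𝕜 := ℂ) (winEffect r (a θ) (M θ) (P θ)) := by
  simp only [GuessingFamily.win, gameFamily, winEffect, ← map_mul, ← map_sum,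
    ← Matrix.mul_kronecker_mul, mul_one, one_mul,
    CFC.sqrt_mul_sqrt_self _ ((hM θ).posSemidef _).nonneg,
    CFC.sqrt_mul_sqrt_self _ ((hP θ _).posSemidef _).nonneg]

lemma trace_mul_conjTranspose_mul_self {X : Type*} [Fintype X] [DecidableEq X] (W G : Op X) :
    (W * (Gᴴ * G)).trace = ∑ k, inner ℂ (WithLp.toLp 2 fun x => star (G k x) : EuclideanSpace ℂ X)
      (Matrix.toEuclideanCLM (𝕜 := ℂ) W (WithLp.toLp 2 fun x => star (G k x))) := by
  rw [← mul_assoc, Matrix.trace_mul_comm, Matrix.trace]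
  refine Finset.sum_congr rfl fun k _ => ?_
  rw [EuclideanSpace.inner_eq_star_dotProduct, Matrix.ofLp_toEuclideanCLM, Matrix.diag_apply,
    Matrix.mul_apply, dotProduct]
  refine Finset.sum_congr rfl fun x _ => ?_
  rw [mul_comm]
  congr 1
  simp

lemma trace_conjTranspose_mul_self_eq {X : Type*} [Fintype X] [DecidableEq X] (G : Op X) :
    (Gᴴ * G).trace.re = ∑ k, ‖(WithLp.toLp 2 fun x => star (G k x) : EuclideanSpace ℂ X)‖ ^ 2 := by
  have h := trace_mul_conjTranspose_mul_self 1 G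
  rw [one_mul] at h
  rw [h, Complex.re_sum]
  refine Finset.sum_congr rfl fun k _ => ?_
  rw [map_one]
  exact inner_self_eq_norm_sq (𝕜 := ℂ) _

lemma card_of_mem_halfSubspaces {a : Submodule (ZMod 2) (Bits n)} (ha : a ∈ halfSubspaces n) :
    Nat.card a = 2 ^ (n / 2) := by
  have h : Module.finrank (ZMod 2) a = n / 2 := ha
  rw [Module.natCard_eq_pow_finrank (K := ZMod 2), h, Nat.card_zmod]

/-- For a family of subspaces whose overlaps have row sums at most `R`, the winning effects add up
to at most `R * Tr J` against any positive operator `J`.  The operator `J` is a sum of rank one operators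
`|ψ⟩⟨ψ|`, and the bound holds for each vector `ψ`. -/
theorem sum_trace_winEffect_le [Fintype Θ] [Nonempty Θ] (hn : Even n) (r : CosetReps n)
    (a : Θ → Submodule (ZMod 2) (Bits n)) (ha : ∀ θ, a θ ∈ halfSubspaces n)
    (M : Θ → Bits (n / 2) → Op B) (hM : ∀ θ, IsPOVM (M θ))
    (P : Θ → Bits (n / 2) → Bits (n / 2) → Op C) (hP : ∀ θ t, IsPOVM (P θ t))
    {R : ℝ} (hR : ∀ θ, ∑ θ', √((Nat.card ↥(a θ ⊓ a θ') : ℝ) / 2 ^ (n / 2)) ≤ R)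
    {J : Op (Bits n × (B × C))} (hJ : J.PosSemidef) :
    ∑ θ, (winEffect r (a θ) (M θ) (P θ) * J).trace.re ≤ R * J.trace.re := by
  obtain ⟨G, hG⟩ := CStarAlgebra.nonneg_iff_eq_star_mul_self.mp hJ.nonneg
  rw [Matrix.star_eq_conjTranspose] at hG
  set X := gameFamily hn r a ha M hM P hP with hX
  have hoverlap : ∀ α β t s s' x, ‖X.E α t (X.e β s s' x)‖ ≤
      √((Nat.card ↥(a α ⊓ a β) : ℝ) / 2 ^ (n / 2)) * ‖x‖ := by
    intro α β t s s' x
    have h1 : X.E α t (X.e β s s' x) = Matrix.toEuclideanCLM (𝕜 := ℂ)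
        (Matrix.vecMulVec (cosetProj r (a α) t *ᵥ cosetKet r (a β) s s')
          (star (cosetKet r (a β) s s')) ⊗ₖ (1 : Op (B × C))) x := by
      rw [← Matrix.mul_vecMulVec, ← mul_one (1 : Op (B × C)), Matrix.mul_kronecker_mul, map_mul]
      rfl
    have h2 : ∑ x, ‖cosetKet r (a β) s s' x‖ ^ 2 = 1 := by
      have h := cosetKet_dotProduct hn r (ha β) s s' s'
      rw [if_pos rfl, dotProduct] at h
      simp only [Pi.star_apply, RCLike.star_def, Complex.conj_mul'] at h
      exact_mod_cast h
    refine le_of_sq_le_sq ?_ (by positivity)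
    rw [h1, mul_pow, Real.sq_sqrt (by positivity)]
    refine (norm_sq_vecMulVec_kronecker_one_apply_le _ _ x).trans ?_
    rw [h2, mul_one]
    gcongr
    have h3 := sum_norm_sq_cosetProj_mulVec_le r (a α) (a β) t s s'
    rwa [card_of_mem_halfSubspaces (ha β), Nat.cast_pow, Nat.cast_ofNat] at h3
  have hψ := fun ψ => X.sum_winProb_le (fun α β => Real.sqrt_nonneg _)
    (fun α β => by rw [inf_comm]) hoverlap hR ψ
  have hterm : ∀ θ, (winEffect r (a θ) (M θ) (P θ) * J).trace.re =
      ∑ k, X.winProb θ (WithLp.toLp 2 fun x => star (G k x)) := by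
    intro θ
    rw [hG, trace_mul_conjTranspose_mul_self, ← gameFamily_win hn r a ha M hM P hP, Complex.re_sum]
    refine Finset.sum_congr rfl fun k _ => ?_
    rw [← hX, X.inner_win, Complex.ofReal_re]
  simp only [hterm]
  rw [hG, trace_conjTranspose_mul_self_eq, Finset.sum_comm, Finset.mul_sum]
  exact Finset.sum_le_sum fun k _ => hψ _

end Family

/-! ### Families of subspaces with small overlaps that cover uniformly -/

section Cover

variable {n : ℕ}

/-- The subspace of the vectors supported on `S`. -/
def coordSubspace (S : Set (Fin n)) : Submodule (ZMod 2) (Bits n) where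
  carrier := {v | ∀ j ∉ S, v j = 0}
  zero_mem' := fun _ _ => rfl
  add_mem' := fun {v w} hv hw j hj => by rw [Pi.add_apply, hv j hj, hw j hj, add_zero]
  smul_mem' := fun c v hv j hj => by rw [Pi.smul_apply, hv j hj, smul_zero]

lemma mem_coordSubspace {S : Set (Fin n)} {v : Bits n} :
    v ∈ coordSubspace S ↔ ∀ j ∉ S, v j = 0 := Iff.rfl

lemma coordSubspace_inf (S S' : Set (Fin n)) :
    coordSubspace S ⊓ coordSubspace S' = coordSubspace (S ∩ S') := by
  ext v
  simp only [Submodule.mem_inf, mem_coordSubspace, Set.mem_inter_iff]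
  exact ⟨fun h j hj => by by_cases hS : j ∈ S; exacts [h.2 j fun h' => hj ⟨hS, h'⟩, h.1 j hS],
    fun h => ⟨fun j hj => h j fun h' => hj h'.1, fun j hj => h j fun h' => hj h'.2⟩⟩

lemma span_single_eq_coordSubspace (S : Set (Fin n)) :
    Submodule.span (ZMod 2) ((fun i => (Pi.single i 1 : Bits n)) '' S) = coordSubspace S := by
  refine le_antisymm (Submodule.span_le.mpr ?_) fun v hv => ?_
  · rintro _ ⟨i, hi, rfl⟩ j hj
    exact Pi.single_eq_of_ne (fun h : j = i => hj (h ▸ hi)) _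
  · rw [pi_eq_sum_univ' v]
    refine Submodule.sum_mem _ fun i _ => ?_
    by_cases hi : i ∈ S
    · exact Submodule.smul_mem _ _ (Submodule.subset_span ⟨i, hi, by
        ext j; simp [Pi.single_apply]⟩)
    · rw [hv i hi, zero_smul]
      exact zero_mem _

lemma card_coordSubspace (S : Set (Fin n)) : Nat.card (coordSubspace S) = 2 ^ S.ncard := by
  classical
  have e : coordSubspace S ≃ (S → ZMod 2) :=
    { toFun := fun v i => (v : Bits n) i
      invFun := fun w => ⟨fun i => if h : i ∈ S then w ⟨i, h⟩ else 0, fun j hj => by simp [hj]⟩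
      left_inv := fun v => by
        ext i
        by_cases h : i ∈ S
        · simp [h]
        · simp [h, v.2 i h]
      right_inv := fun w => by ext i; simp }
  rw [Nat.card_congr e, Nat.card_fun, Nat.card_zmod, Set.ncard]
  rfl

lemma finrank_coordSubspace (S : Set (Fin n)) :
    Module.finrank (ZMod 2) (coordSubspace S) = S.ncard := by
  have h := Module.natCard_eq_pow_finrank (K := ZMod 2) (V := coordSubspace S)
  rw [card_coordSubspace, Nat.card_zmod] at h
  exact (Nat.pow_right_injective le_rfl h).symm

lemma coordSubspace_mem_registerSubspaces {S : Set (Fin n)} (hS : S.ncard = n / 2) :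
    coordSubspace S ∈ registerSubspaces n :=
  ⟨(finrank_coordSubspace S).trans hS, S, (span_single_eq_coordSubspace S).symm⟩

lemma exists_of_mem_registerSubspaces {a : Submodule (ZMod 2) (Bits n)}
    (ha : a ∈ registerSubspaces n) : ∃ S : Set (Fin n), S.ncard = n / 2 ∧ a = coordSubspace S := by
  obtain ⟨h, S, rfl⟩ := ha
  rw [span_single_eq_coordSubspace] at h ⊢
  exact ⟨S, (finrank_coordSubspace S).symm.trans h, rfl⟩

lemma exists_pairing (hn : Even n) : Nonempty (Fin (n / 2) × Bool ≃ Fin n) := by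
  refine ⟨Fintype.equivOfCardEq ?_⟩
  simp only [Fintype.card_prod, Fintype.card_fin, Fintype.card_bool]
  obtain ⟨k, rfl⟩ := hn
  omega

lemma transversal_injective (e : Fin (n / 2) × Bool ≃ Fin n) (θ : Fin (n / 2) → Bool) :
    Function.Injective fun i => e (i, θ i) :=
  fun _ _ h => congrArg Prod.fst (e.injective h)

lemma ncard_transversal (e : Fin (n / 2) × Bool ≃ Fin n) (θ : Fin (n / 2) → Bool) :
    (Set.range fun i => e (i, θ i)).ncard = n / 2 := by
  rw [← Set.image_univ, Set.ncard_image_of_injective _ (transversal_injective e θ), Set.ncard_univ,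
    Nat.card_fin]

lemma ncard_transversal_inter (e : Fin (n / 2) × Bool ≃ Fin n) (θ θ' : Fin (n / 2) → Bool) :
    ((Set.range fun i => e (i, θ i)) ∩ Set.range fun i => e (i, θ' i)).ncard =
      (Finset.univ.filter fun i => θ i = θ' i).card := by
  have : ((Set.range fun i => e (i, θ i)) ∩ Set.range fun i => e (i, θ' i)) =
      (fun i => e (i, θ i)) '' ((Finset.univ.filter fun i => θ i = θ' i : Finset _) : Set _) := by
    ext j
    simp only [Set.mem_inter_iff, Set.mem_range, Set.mem_image, Finset.coe_filter,
      Finset.mem_univ, true_and, Set.mem_ofPred_eq]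
    constructor
    · rintro ⟨⟨i, rfl⟩, k, hk⟩
      have h := e.injective hk
      simp only [Prod.mk.injEq] at h
      obtain ⟨rfl, h⟩ := h
      exact ⟨k, h.symm, rfl⟩
    · rintro ⟨i, hi, rfl⟩
      exact ⟨⟨i, rfl⟩, i, by rw [hi]⟩
  rw [this, Set.ncard_image_of_injective _ (transversal_injective e θ), Set.ncard_coe_finset]

/-- An orbit of a transitive action runs uniformly through the whole space. -/
lemma card_mul_sum_smul {G X : Type*} [Group G] [Fintype G] [Fintype X] [MulAction G X]
    [MulAction.IsPretransitive G X] (f : X → ℝ) (x : X) :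
    Fintype.card X * ∑ g : G, f (g • x) = Fintype.card G * ∑ y, f y := by
  have h1 : ∀ y, ∑ g : G, f (g • y) = ∑ g : G, f (g • x) := by
    intro y
    obtain ⟨h, rfl⟩ := MulAction.exists_smul_eq G x y
    simp only [smul_smul]
    exact Equiv.sum_comp (Equiv.mulRight h) fun g => f (g • x)
  have h2 : ∀ g : G, ∑ y, f (g • y) = ∑ y, f y := fun g =>
    Equiv.sum_comp (MulAction.toPerm g) f
  calc (Fintype.card X : ℝ) * ∑ g : G, f (g • x) = ∑ y : X, ∑ g : G, f (g • y) := by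
        simp only [h1, Finset.sum_const, Finset.card_univ, nsmul_eq_mul]
    _ = ∑ g : G, ∑ y : X, f (g • y) := Finset.sum_comm
    _ = _ := by simp only [h2, Finset.sum_const, Finset.card_univ, nsmul_eq_mul]

/-- A set `A` of subspaces that is an orbit under a group of linear automorphisms, and that contains
the coordinate subspaces of all transversals of a pairing of the coordinates, is covered uniformly
by translates of this family of `2 ^ (n / 2)` coordinate subspaces. -/
lemma exists_uniform_cover_of_orbit (e : Fin (n / 2) × Bool ≃ Fin n)
    (A : Finset (Submodule (ZMod 2) (Bits n))) {G : Type} [Group G] [Finite G]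
    (φ : G →* (Bits n ≃ₗ[ZMod 2] Bits n))
    (hstab : ∀ g, ∀ a ∈ A, a.map (φ g).toLinearMap ∈ A)
    (htrans : ∀ a ∈ A, ∀ b ∈ A, ∃ g, a.map (φ g).toLinearMap = b)
    (hmem : ∀ θ : Fin (n / 2) → Bool, coordSubspace (Set.range fun i => e (i, θ i)) ∈ A) :
    ∃ (I : Type) (_ : Fintype I) (_ : Nonempty I) (Y : I → (Fin (n / 2) → Bool) → A),
      (∀ g θ θ', Nat.card ↥((Y g θ : Submodule (ZMod 2) (Bits n)) ⊓ Y g θ') =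
        2 ^ (Finset.univ.filter fun i => θ i = θ' i).card) ∧
      ∀ f : A → ℝ, Fintype.card A * ∑ g, ∑ θ, f (Y g θ) =
        Fintype.card I * 2 ^ (n / 2) * ∑ a, f a := by
  have := Fintype.ofFinite G
  let _ : MulAction G A :=
    { smul := fun g a => ⟨(a : Submodule (ZMod 2) (Bits n)).map (φ g).toLinearMap, hstab g a a.2⟩
      one_smul := fun a => Subtype.ext (by
        change Submodule.map (φ 1).toLinearMap _ = _
        rw [map_one]
        exact Submodule.map_id _)
      mul_smul := fun g h a => Subtype.ext (by
        change Submodule.map (φ (g * h)).toLinearMap _ =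
          Submodule.map (φ g).toLinearMap (Submodule.map (φ h).toLinearMap _)
        rw [map_mul, ← Submodule.map_comp]
        rfl) }
  have : MulAction.IsPretransitive G A := ⟨fun a b => by
    obtain ⟨g, hg⟩ := htrans a a.2 b b.2
    exact ⟨g, Subtype.ext hg⟩⟩
  refine ⟨G, inferInstance, inferInstance, fun g θ => g • ⟨_, hmem θ⟩, fun g θ θ' => ?_, fun f => ?_⟩
  · change Nat.card ↥(Submodule.map (φ g).toLinearMap _ ⊓ Submodule.map (φ g).toLinearMap _) = _
    rw [← Submodule.map_inf _ (φ g).injective, coordSubspace_inf, ← ncard_transversal_inter e θ θ',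
      ← card_coordSubspace]
    exact Nat.card_congr ((φ g).submoduleMap _).symm.toEquiv
  · rw [Finset.sum_comm, Finset.mul_sum]
    simp only [card_mul_sum_smul f, Finset.sum_const, Finset.card_univ, nsmul_eq_mul]
    simp only [Fintype.card_fun, Fintype.card_bool, Fintype.card_fin]
    push_cast
    ring

/-- Permutations of the coordinates, as linear automorphisms. -/
def permHom : Equiv.Perm (Fin n) →* (Bits n ≃ₗ[ZMod 2] Bits n) where
  toFun σ := LinearEquiv.funCongrLeft (ZMod 2) (ZMod 2) σ.symm
  map_one' := rfl
  map_mul' _ _ := rfl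

lemma map_permHom_coordSubspace (σ : Equiv.Perm (Fin n)) (S : Set (Fin n)) :
    (coordSubspace S).map (permHom σ).toLinearMap = coordSubspace (σ '' S) := by
  ext v
  rw [Submodule.mem_map]
  constructor
  · rintro ⟨w, hw, rfl⟩ j hj
    exact hw _ fun h => hj ⟨_, h, σ.apply_symm_apply j⟩
  · intro hv
    refine ⟨fun i => v (σ i), fun j hj => hv _ fun h => hj ?_, ?_⟩
    · obtain ⟨k, hk, hkj⟩ := h
      rwa [← σ.injective hkj]
    · ext i
      exact congrArg v (σ.apply_symm_apply i)

lemma exists_perm_image_eq {S S' : Set (Fin n)} (h : S.ncard = S'.ncard) :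
    ∃ σ : Equiv.Perm (Fin n), σ '' S = S' := by
  classical
  obtain ⟨e⟩ : Nonempty ({x // x ∈ S} ≃ {x // x ∈ S'}) := Finite.card_eq.mp h
  refine ⟨e.extendSubtype, Set.eq_of_subset_of_ncard_le ?_ ?_⟩
  · rintro _ ⟨x, hx, rfl⟩
    exact e.extendSubtype_mem x hx
  · rw [Set.ncard_image_of_injective _ (Equiv.injective _), h]

/-- The linear automorphisms act transitively on the subspaces of a given dimension. -/
lemma exists_linearEquiv_map_eq {a b : Submodule (ZMod 2) (Bits n)}
    (h : Module.finrank (ZMod 2) a = Module.finrank (ZMod 2) b) :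
    ∃ φ : Bits n ≃ₗ[ZMod 2] Bits n, a.map φ.toLinearMap = b := by
  obtain ⟨a', ha⟩ := a.exists_isCompl
  obtain ⟨b', hb⟩ := b.exists_isCompl
  have h' : Module.finrank (ZMod 2) a' = Module.finrank (ZMod 2) b' := by
    have h1 := Submodule.finrank_add_eq_of_isCompl ha
    have h2 := Submodule.finrank_add_eq_of_isCompl hb
    omega
  let φ := (Submodule.prodEquivOfIsCompl a a' ha).symm ≪≫ₗ
    ((LinearEquiv.ofFinrankEq _ _ h).prodCongr (LinearEquiv.ofFinrankEq _ _ h')) ≪≫ₗ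
    Submodule.prodEquivOfIsCompl b b' hb
  refine ⟨φ, Submodule.eq_of_le_of_finrank_eq ?_ ?_⟩
  · rintro _ ⟨v, hv, rfl⟩
    have := Submodule.prodEquivOfIsCompl_symm_apply_left a a' ha ⟨v, hv⟩
    simp only at this
    simp [φ, this]
  · rw [← h]
    exact LinearEquiv.finrank_map_eq φ a

/-- The register subspaces, and all subspaces of half dimension, are covered uniformly by families
of `2 ^ (n / 2)` subspaces `Y g θ` such that `Y g θ ⊓ Y g θ'` has as dimension the number of
positions in which `θ` and `θ'` agree. -/
theorem exists_uniform_cover (hn : Even n) (A : Finset (Submodule (ZMod 2) (Bits n)))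
    (hA : (A : Set (Submodule (ZMod 2) (Bits n))) = registerSubspaces n ∨
      (A : Set (Submodule (ZMod 2) (Bits n))) = halfSubspaces n) :
    ∃ (I : Type) (_ : Fintype I) (_ : Nonempty I) (Y : I → (Fin (n / 2) → Bool) → A),
      (∀ g θ θ', Nat.card ↥((Y g θ : Submodule (ZMod 2) (Bits n)) ⊓ Y g θ') =
        2 ^ (Finset.univ.filter fun i => θ i = θ' i).card) ∧
      ∀ f : A → ℝ, Fintype.card A * ∑ g, ∑ θ, f (Y g θ) =
        Fintype.card I * 2 ^ (n / 2) * ∑ a, f a := by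
  obtain ⟨e⟩ := exists_pairing hn
  rcases hA with hA | hA
  · have hmem : ∀ a, a ∈ A ↔ a ∈ registerSubspaces n := fun a => by rw [← hA, Finset.mem_coe]
    refine exists_uniform_cover_of_orbit e A permHom (fun σ a ha => ?_) (fun a ha b hb => ?_)
      fun θ => ?_
    · rw [hmem] at ha ⊢
      obtain ⟨S, hS, rfl⟩ := exists_of_mem_registerSubspaces ha
      rw [map_permHom_coordSubspace]
      exact coordSubspace_mem_registerSubspaces
        ((Set.ncard_image_of_injective _ σ.injective).trans hS)
    · rw [hmem] at ha hb
      obtain ⟨S, hS, rfl⟩ := exists_of_mem_registerSubspaces ha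
      obtain ⟨S', hS', rfl⟩ := exists_of_mem_registerSubspaces hb
      obtain ⟨σ, rfl⟩ := exists_perm_image_eq (hS.trans hS'.symm)
      exact ⟨σ, map_permHom_coordSubspace σ S⟩
    · rw [hmem]
      exact coordSubspace_mem_registerSubspaces (ncard_transversal e θ)
  · have hmem : ∀ a, a ∈ A ↔ Module.finrank (ZMod 2) a = n / 2 := fun a => by
      rw [← Finset.mem_coe, hA]; rfl
    have : Finite (Bits n ≃ₗ[ZMod 2] Bits n) :=
      Finite.of_injective (fun φ => (φ : Bits n → Bits n)) DFunLike.coe_injective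
    refine exists_uniform_cover_of_orbit e A (MonoidHom.id _) (fun φ a ha => ?_)
      (fun a ha b hb => ?_) fun θ => ?_
    · rw [hmem] at ha ⊢
      exact (LinearEquiv.finrank_map_eq φ a).trans ha
    · rw [hmem] at ha hb
      exact exists_linearEquiv_map_eq (ha.trans hb.symm)
    · rw [hmem, finrank_coordSubspace, ncard_transversal]

/-- The row sum of the overlaps of a transversal family factorizes over the pairs: at each pair `θ'`
either agrees with `θ`, or loses a factor `√(1 / 2)`. -/
lemma sum_sqrt_overlap (m : ℕ) (θ : Fin m → Bool) :
    ∑ θ' : Fin m → Bool, √((2 ^ (Finset.univ.filter fun i => θ i = θ' i).card : ℝ) / 2 ^ m) =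
      (1 + √(1 / 2)) ^ m := by
  have h : ∀ θ' : Fin m → Bool,
      √((2 ^ (Finset.univ.filter fun i => θ i = θ' i).card : ℝ) / 2 ^ m) =
        ∏ i, if θ i = θ' i then 1 else √(1 / 2) := by
    intro θ'
    rw [Real.sqrt_eq_iff_mul_self_eq (by positivity)
      (Finset.prod_nonneg fun i _ => by split_ifs <;> positivity), ← Finset.prod_mul_distrib]
    have h1 : ∀ i, ((if θ i = θ' i then 1 else √(1 / 2)) * if θ i = θ' i then 1 else √(1 / 2) : ℝ) =
        (if θ i = θ' i then 2 else 1) / 2 := by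
      intro i
      split_ifs
      · norm_num
      · rw [Real.mul_self_sqrt (by norm_num)]
    simp only [h1, Finset.prod_div_distrib, Finset.prod_const, Finset.card_univ, Fintype.card_fin]
    rw [Finset.prod_ite]
    simp
  have h2 := Finset.prod_univ_sum (fun _ : Fin m => (Finset.univ : Finset Bool))
    fun i b => if θ i = b then (1 : ℝ) else √(1 / 2)
  simp only [Fintype.piFinset_univ] at h2
  simp only [h, ← h2]
  have h3 : ∀ i, ∑ b : Bool, (if θ i = b then (1 : ℝ) else √(1 / 2)) = 1 + √(1 / 2) := by
    intro i
    rw [Fintype.sum_bool]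
    cases θ i <;> simp [add_comm]
  simp only [h3, Finset.prod_const, Finset.card_univ, Fintype.card_fin]

lemma one_add_sqrt_half_pow (hn : Even n) :
    (1 + √(1 / 2)) ^ (n / 2) = 2 ^ (n / 2) * Real.cos (Real.pi / 8) ^ n := by
  obtain ⟨k, rfl⟩ := hn
  rw [show (k + k) / 2 = k by omega, ← two_mul, pow_mul, ← mul_pow, Real.cos_sq]
  congr 1
  rw [show 2 * (Real.pi / 8) = Real.pi / 4 by ring, Real.cos_pi_div_four,
    Real.sqrt_div' _ (by norm_num), Real.sqrt_one]
  have h : √2 * √2 = 2 := Real.mul_self_sqrt (by norm_num)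
  have h0 : √2 ≠ 0 := by positivity
  field_simp
  linarith

end Cover

/-! ### The Choi matrix of a channel -/

section Choi

variable {X Y : Type*} [Fintype X] [DecidableEq X] [Fintype Y]

/-- The Choi matrix of `Φ`, whose block at `(x, x')` is `Φ(|x⟩⟨x'|)`. -/
def choi (Φ : Op X →ₗ[ℂ] Op Y) : Op (X × Y) :=
  Matrix.of fun p q => Φ (Matrix.single p.1 q.1 1) p.2 q.2

/-- The Choi matrix is the image of the unnormalized maximally entangled state. -/
lemma choi_posSemidef {X : Type} [Fintype X] [DecidableEq X] {Φ : Op X →ₗ[ℂ] Op Y}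
    (hΦ : IsChannel Φ) : (choi Φ).PosSemidef := by
  have h := hΦ.completely_positive X _
    (ketbra_posSemidef fun p : X × X => if p.1 = p.2 then 1 else 0)
  suffices choi Φ = idTensor X Φ (ketbra fun p : X × X => if p.1 = p.2 then 1 else 0) by
    rwa [this]
  ext p q
  simp only [choi, idTensor, Matrix.of_apply]
  refine congrArg (fun N => Φ N p.2 q.2) ?_
  ext x x'
  simp [ketbra, Matrix.vecMulVec_apply, Matrix.single_apply, ite_and]
  split_ifs <;> rfl

lemma trace_choi {Φ : Op X →ₗ[ℂ] Op Y} (hΦ : IsChannel Φ) :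
    (choi Φ).trace = Fintype.card X := by
  have h : (choi Φ).trace = ∑ x, (Φ (Matrix.single x x 1)).trace := by
    rw [Matrix.trace, Fintype.sum_prod_type]
    rfl
  simp [h, hΦ.trace_preserving]

/-- The Choi matrix turns the evaluation of the channel into a trace pairing. -/
lemma trace_kronecker_mul_choi (Φ : Op X →ₗ[ℂ] Op Y) (P : Op X) (N : Op Y) :
    ((P ⊗ₖ N) * choi Φ).trace = (N * Φ Pᵀ).trace := by
  have h : Pᵀ = ∑ x, ∑ x', P x x' • Matrix.single x' x (1 : ℂ) := by
    rw [Finset.sum_comm]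
    conv_lhs => rw [Matrix.matrix_eq_sum_single Pᵀ]
    simp
  rw [h]
  simp only [map_sum, map_smul, Matrix.mul_sum, Matrix.trace_sum, Matrix.mul_smul,
    Matrix.trace_smul]
  simp only [Matrix.trace, Matrix.diag_apply, Matrix.mul_apply, Fintype.sum_prod_type,
    Matrix.kroneckerMap_apply, choi, Matrix.of_apply, smul_eq_mul, Finset.mul_sum]
  refine Finset.sum_congr rfl fun x _ => ?_
  rw [Finset.sum_comm]
  refine Finset.sum_congr rfl fun x' _ => Finset.sum_congr rfl fun y _ =>
    Finset.sum_congr rfl fun y' _ => ?_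
  ring

end Choi

/-! ### Block-diagonal states -/

section Blocks

lemma cstate_posSemidef {X : Type*} [Fintype X] [DecidableEq X] (x : X) :
    (cstate x).PosSemidef := by
  rw [cstate, ← Matrix.diagonal_single]
  exact Matrix.PosSemidef.diagonal (Pi.single_nonneg.mpr zero_le_one)

lemma sum_cstate_kronecker_apply {X Y : Type*} [Fintype X] [DecidableEq X] (ρ : X → Op Y)
    (p q : X × Y) :
    (∑ x, cstate x ⊗ₖ ρ x) p q = if p.1 = q.1 then ρ p.1 p.2 q.2 else 0 := by
  simp only [Matrix.sum_apply, Matrix.kroneckerMap_apply, cstate, Matrix.single_apply, ite_and,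
    ite_mul, one_mul, zero_mul, Finset.sum_ite_eq', Finset.mem_univ, if_true]

lemma sum_cstate_kronecker_posSemidef {X Y : Type*} [Fintype X] [DecidableEq X] [Fintype Y]
    {ρ : X → Op Y} (hρ : ∀ x, (ρ x).PosSemidef) : (∑ x, cstate x ⊗ₖ ρ x).PosSemidef :=
  Matrix.posSemidef_sum _ fun x _ => (cstate_posSemidef x).kronecker (hρ x)

lemma negLg_antitone : Antitone negLg := by
  intro x y hxy
  unfold negLg
  split_ifs with hy hx hx
  · exact le_rfl
  · exact absurd (hxy.trans hy) hx
  · exact le_top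
  · rw [EReal.coe_le_coe_iff, neg_le_neg_iff]
    exact Real.logb_le_logb_of_le one_lt_two (not_le.mp hx) hxy

/-- Any common upper bound `σ` of the blocks of a block-diagonal state bounds its min-entropy from
below. -/
lemma negLg_le_Hmin {X Y : Type*} [Fintype X] [DecidableEq X] [Fintype Y]
    (ρ : X → Op Y) {σ : Op Y} (hσ : σ.PosSemidef) (h : ∀ x, (σ - ρ x).PosSemidef) :
    negLg σ.trace.re ≤ Hmin (∑ x, cstate x ⊗ₖ ρ x) := by
  refine negLg_antitone (csInf_le ⟨0, ?_⟩ ⟨σ, hσ, ?_, rfl⟩)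
  · rintro _ ⟨τ, hτ, -, rfl⟩
    exact (Complex.le_def.mp hτ.trace_nonneg).1
  · rw [Matrix.le_iff]
    suffices (1 : Op X) ⊗ₖ σ - ∑ x, cstate x ⊗ₖ ρ x = ∑ x, cstate x ⊗ₖ (σ - ρ x) by
      rw [this]
      exact sum_cstate_kronecker_posSemidef h
    ext p q
    rw [Matrix.sub_apply, sum_cstate_kronecker_apply, sum_cstate_kronecker_apply,
      Matrix.kroneckerMap_apply, Matrix.one_apply]
    split_ifs <;> simp

lemma negLg_ne_bot (x : ℝ) : negLg x ≠ ⊥ := by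
  unfold negLg
  split_ifs
  · exact top_ne_bot
  · exact EReal.coe_ne_bot _

lemma neg_logb_le_negLg_add_negLg {x y p : ℝ} (hxy : x * y ≤ p) :
    ((-Real.logb 2 p : ℝ) : EReal) ≤ negLg x + negLg y := by
  by_cases hx : x ≤ 0
  · rw [show negLg x = ⊤ from if_pos hx, EReal.top_add_of_ne_bot (negLg_ne_bot y)]
    exact le_top
  by_cases hy : y ≤ 0
  · rw [show negLg y = ⊤ from if_pos hy, EReal.add_top_of_ne_bot (negLg_ne_bot x)]
    exact le_top
  push Not at hx hy
  rw [negLg, negLg, if_neg hx.not_ge, if_neg hy.not_ge, ← EReal.coe_add, EReal.coe_le_coe_iff,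
    ← neg_add, neg_le_neg_iff, ← Real.logb_mul hx.ne' hy.ne']
  exact Real.logb_le_logb_of_le one_lt_two (mul_pos hx hy) hxy

end Blocks

/-! ### The states of Bob and Charlie -/

section States

lemma partialGuess_eq {X A R : Type*} [Fintype X] [DecidableEq X] [Fintype A] [DecidableEq A]
    (M : X → Op A) (ρ : Op (X × A × R)) (p q : X × A × R) :
    partialGuess M ρ p q = if p.1 = q.1 then ∑ b', (∑ b, CFC.sqrt (M p.1) p.2.1 b *
      ρ (p.1, b, p.2.2) (p.1, b', q.2.2)) * CFC.sqrt (M p.1) b' q.2.1 else 0 := by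
  obtain ⟨x, a, z⟩ := p
  obtain ⟨x', a', z'⟩ := q
  have h : ∀ s : X, ∀ N : Op A, ndMeasure M N (s, a) (s, a') =
      (CFC.sqrt (M s) * N * CFC.sqrt (M s)) a a' := by
    intro s N
    change (∑ s, cstate s ⊗ₖ (CFC.sqrt (M s) * N * CFC.sqrt (M s))) (s, a) (s, a') = _
    rw [sum_cstate_kronecker_apply, if_pos rfl]
  simp only [partialGuess, trFst, relabel, partialState, idTensor, Matrix.of_apply,
    Matrix.submatrix_apply, Prod.mk.injEq, true_and, h]
  by_cases hx : x = x'
  · subst hx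
    simp [Matrix.mul_apply]
  · simp [hx]

lemma partialGuess_posSemidef {X A R : Type*} [Fintype X] [DecidableEq X] [Fintype A]
    [DecidableEq A] [Fintype R] (M : X → Op A) {ρ : Op (X × A × R)} (hρ : ρ.PosSemidef) :
    (partialGuess M ρ).PosSemidef := by
  classical
  have h : partialGuess M ρ = ∑ x, cstate x ⊗ₖ ((CFC.sqrt (M x) ⊗ₖ (1 : Op R)) *
      ρ.submatrix (Prod.mk x) (Prod.mk x) * (CFC.sqrt (M x) ⊗ₖ (1 : Op R))) := by
    ext p q
    rw [sum_cstate_kronecker_apply, partialGuess_eq]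
    congr 1
    simp [Matrix.mul_apply, Fintype.sum_prod_type, Matrix.one_apply]
  rw [h]
  refine sum_cstate_kronecker_posSemidef fun x => ?_
  have hs : (CFC.sqrt (M x) ⊗ₖ (1 : Op R))ᴴ = CFC.sqrt (M x) ⊗ₖ (1 : Op R) :=
    isSelfAdjoint_kronecker (CFC.sqrt_nonneg _).isSelfAdjoint (.one _)
  have := (hρ.submatrix (Prod.mk x)).conjTranspose_mul_mul_same (CFC.sqrt (M x) ⊗ₖ (1 : Op R))
  rwa [hs] at this

lemma IsPOVM.submatrix {S X Y : Type*} [Fintype S] [DecidableEq X] [DecidableEq Y]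
    {P : S → Op X} (hP : IsPOVM P) {f : Y → X} (hf : Function.Injective f) :
    IsPOVM fun s => (P s).submatrix f f := by
  refine ⟨fun s => (hP.posSemidef s).submatrix f, ?_⟩
  ext i j
  have h := congrFun (congrFun hP.sum_eq_one (f i)) (f j)
  rw [Matrix.sum_apply] at h ⊢
  simp only [Matrix.submatrix_apply, h, Matrix.one_apply, hf.eq_iff]

lemma charlieMarginal_smul {T A B A' T' C : Type*} [Fintype A] [Fintype B] (c : ℂ)
    (ρ : Op (T × (A × B) × (A' × T' × C))) :
    charlieMarginal (c • ρ) = c • charlieMarginal ρ := by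
  ext p q
  simp [charlieMarginal, trFst, relabel, Finset.mul_sum]

lemma charlieMarginal_posSemidef {T A B A' T' C : Type*} [Fintype A] [Fintype B]
    {ρ : Op (T × (A × B) × (A' × T' × C))} (hρ : ρ.PosSemidef) :
    (charlieMarginal ρ).PosSemidef := by
  have h : charlieMarginal ρ = ∑ x : A × B, ρ.submatrix
      (fun p : T' × (A' × T × C) => (p.2.2.1, x, (p.2.1, p.1, p.2.2.2)))
      (fun p : T' × (A' × T × C) => (p.2.2.1, x, (p.2.1, p.1, p.2.2.2))) := by
    ext p q
    rw [Matrix.sum_apply]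
    rfl
  rw [h]
  exact Matrix.posSemidef_sum _ fun x _ => hρ.submatrix _

/-- After the registers `AB` are traced out, the two square roots of Bob's effect merge into the
effect itself. -/
lemma charlieMarginal_partialGuess_apply {T A B A' T' C : Type*} [Fintype T] [DecidableEq T]
    [Fintype A] [DecidableEq A] [Fintype B] [DecidableEq B] {M : T → Op (A × B)} (hM : IsPOVM M)
    (ρ : Op (T × (A × B) × (A' × T' × C))) (t' u' : T') (q q' : A' × T × C) :
    charlieMarginal (partialGuess M ρ) (t', q) (u', q') = if q.2.1 = q'.2.1 then
      ∑ y : A × B, ∑ y' : A × B, M q.2.1 y' y *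
        ρ (q.2.1, y, (q.1, t', q.2.2)) (q.2.1, y', (q'.1, u', q'.2.2)) else 0 := by
  simp only [charlieMarginal, trFst, relabel, Matrix.of_apply, Matrix.submatrix_apply,
    partialGuess_eq]
  split_ifs with h
  · have hs : ∀ y' y, M q.2.1 y' y =
        ∑ x, CFC.sqrt (M q.2.1) y' x * CFC.sqrt (M q.2.1) x y := by
      intro y' y
      rw [← Matrix.mul_apply, CFC.sqrt_mul_sqrt_self _ (hM.posSemidef _).nonneg]
    simp only [hs, Finset.sum_mul]
    rw [Finset.sum_comm_cycle]
    refine Finset.sum_congr rfl fun y _ => ?_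
    rw [Finset.sum_comm]
    refine Finset.sum_congr rfl fun y' _ => Finset.sum_congr rfl fun x _ => ?_
    rw [h]
    ring
  · simp

variable {n : ℕ} [DecidableEq (Submodule (ZMod 2) (Bits n))]

lemma aliceState_posSemidef (A : Finset (Submodule (ZMod 2) (Bits n))) (r : CosetReps n) :
    (aliceState A r).PosSemidef := by
  refine Matrix.PosSemidef.smul ?_ (inv_nonneg.mpr (Nat.cast_nonneg _))
  exact Matrix.posSemidef_sum _ fun _ _ => Matrix.posSemidef_sum _ fun _ _ =>
    Matrix.posSemidef_sum _ fun _ _ => (cstate_posSemidef _).kronecker (ketbra_posSemidef _)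

lemma gameStateBob_posSemidef (A : Finset (Submodule (ZMod 2) (Bits n))) (r : CosetReps n)
    {B C : Type*} [Fintype B] [Fintype C] {Φ : Op (Bits n) →ₗ[ℂ] Op (B × C)} (hΦ : IsChannel Φ) :
    (gameStateBob A r Φ).PosSemidef :=
  (hΦ.completely_positive _ _ (aliceState_posSemidef A r)).submatrix _

lemma gameStateBob_apply (A : Finset (Submodule (ZMod 2) (Bits n))) (r : CosetReps n)
    {B C : Type*} (Φ : Op (Bits n) →ₗ[ℂ] Op (B × C)) (t t' u' : Bits (n / 2)) (a a' a₁ a₁' : A)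
    (b b₁ : B) (c c₁ : C) :
    gameStateBob A r Φ (t, (a, b), (a', t', c)) (t, (a₁, b₁), (a₁', u', c₁)) =
      if a = a' ∧ a₁ = a' ∧ a₁' = a' ∧ t' = u' then
        ((Fintype.card (A × Bits (n / 2) × Bits (n / 2)) : ℕ) : ℂ)⁻¹ *
          Φ (ketbra (cosetKet r a' t t')) (b, c) (b₁, c₁) else 0 := by
  have h : ∀ x x', aliceState A r ((a, a', t, t'), x) ((a₁, a₁', t, u'), x') =
      if a = a' ∧ a₁ = a' ∧ a₁' = a' ∧ t' = u' then
        ((Fintype.card (A × Bits (n / 2) × Bits (n / 2)) : ℕ) : ℂ)⁻¹ *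
          ketbra (cosetKet r a' t t') x x' else 0 := by
    intro x x'
    simp only [aliceState, Matrix.smul_apply, Matrix.sum_apply, Matrix.kroneckerMap_apply, cstate,
      Matrix.single_apply, Prod.mk.injEq, smul_eq_mul]
    split_ifs with h
    · obtain ⟨rfl, rfl, rfl, rfl⟩ := h
      simp [ite_and]
    · rw [Finset.sum_eq_zero fun a₀ _ => Finset.sum_eq_zero fun s _ =>
        Finset.sum_eq_zero fun s' _ => ?_, mul_zero]
      rw [if_neg, zero_mul]
      rintro ⟨⟨rfl, rfl, rfl, rfl⟩, rfl, rfl, -, rfl⟩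
      exact h ⟨rfl, rfl, rfl, rfl⟩
  change Φ (Matrix.of fun x x' => aliceState A r ((a, a', t, t'), x) ((a₁, a₁', t, u'), x'))
    (b, c) (b₁, c₁) = _
  simp only [h]
  split_ifs with h1
  · rw [show (Matrix.of fun x x' => ((Fintype.card (A × Bits (n / 2) × Bits (n / 2)) : ℕ) : ℂ)⁻¹ *
        ketbra (cosetKet r a' t t') x x') =
        ((Fintype.card (A × Bits (n / 2) × Bits (n / 2)) : ℕ) : ℂ)⁻¹ •
          ketbra (cosetKet r a' t t') from rfl, map_smul]
    rfl
  · rw [show (Matrix.of fun _ _ => 0 : Op (Bits n)) = 0 from rfl, map_zero]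
    rfl

end States

/-! ### The bound on Charlie's guess -/

section Final

variable {n : ℕ} [DecidableEq (Submodule (ZMod 2) (Bits n))]
  (A : Finset (Submodule (ZMod 2) (Bits n))) (r : CosetReps n)
  {B C : Type*} [Fintype B] [DecidableEq B]

/-- Charlie's state is diagonal in the classical registers `T'`, `A'` and `T`.  The copy `A'` also
restricts Bob's effect to its block at `a`. -/
lemma charlieState_apply (Φ : Op (Bits n) →ₗ[ℂ] Op (B × C))
    {M : Bits (n / 2) → Op (A × B)} (hM : IsPOVM M) (t' u' t t₁ : Bits (n / 2)) (a a₁ : A)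
    (c c₁ : C) :
    charlieMarginal (partialGuess M (gameStateBob A r Φ)) (t', (a, t, c)) (u', (a₁, t₁, c₁)) =
      if t' = u' ∧ a = a₁ ∧ t = t₁ then
        ((Fintype.card (A × Bits (n / 2) × Bits (n / 2)) : ℕ) : ℂ)⁻¹ * ∑ b, ∑ b₁,
          M t (a, b₁) (a, b) * Φ (ketbra (cosetKet r a t t')) (b, c) (b₁, c₁) else 0 := by
  rw [charlieMarginal_partialGuess_apply hM]
  simp only [Fintype.sum_prod_type, gameStateBob_apply]
  by_cases h : t' = u' ∧ a = a₁ ∧ t = t₁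
  · obtain ⟨rfl, rfl, rfl⟩ := h
    simp [ite_and, Finset.mul_sum, Finset.sum_ite_irrel, mul_left_comm]
  · rw [if_neg h]
    split_ifs with ht
    · refine Finset.sum_eq_zero fun x _ => Finset.sum_eq_zero fun b _ =>
        Finset.sum_eq_zero fun x₁ _ => Finset.sum_eq_zero fun b₁ _ => ?_
      rw [if_neg, mul_zero]
      rintro ⟨-, -, h1, h2⟩
      exact h ⟨h2, h1.symm, ht⟩
    · rfl

/-- Charlie's guess for `t'`, in the blocks of the classical registers `a` and `t` that he holds,
is a measurement of his register `C` alone. -/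
lemma sum_trace_charlieState_eq [Fintype C] (Φ : Op (Bits n) →ₗ[ℂ] Op (B × C))
    {M : Bits (n / 2) → Op (A × B)} (hM : IsPOVM M)
    (Q : Bits (n / 2) → Op (A × Bits (n / 2) × C)) :
    ∑ t', (Q t' * (charlieMarginal (partialGuess M (gameStateBob A r Φ))).submatrix
      (Prod.mk t') (Prod.mk t')).trace =
    ((Fintype.card (A × Bits (n / 2) × Bits (n / 2)) : ℕ) : ℂ)⁻¹ * ∑ a : A,
      (winEffect r a (fun t => (M t).submatrix (Prod.mk a) (Prod.mk a))
        (fun t t' => (Q t').submatrix (fun c => (a, t, c)) (fun c => (a, t, c))) *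
          choi Φ).trace := by
  have hT : ∀ (a : A) (t t' : Bits (n / 2)),
      (ketbra (cosetKet r a t t'))ᵀ = ketbra (cosetKet r a t t') := fun a t t' => by
    rw [ketbra, Matrix.transpose_vecMulVec, cosetKet, star_cosetVec]
  simp only [winEffect, Finset.sum_mul, Matrix.trace_sum, trace_kronecker_mul_choi,
    hT]
  have h1 : ∀ t', (Q t' * (charlieMarginal (partialGuess M (gameStateBob A r Φ))).submatrix
      (Prod.mk t') (Prod.mk t')).trace = ∑ a : A, ∑ t,
      ((Fintype.card (A × Bits (n / 2) × Bits (n / 2)) : ℕ) : ℂ)⁻¹ *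
        ((M t).submatrix (Prod.mk a) (Prod.mk a) ⊗ₖ
          (Q t').submatrix (fun c => (a, t, c)) (fun c => (a, t, c)) *
            Φ (ketbra (cosetKet r a t t'))).trace := by
    intro t'
    simp only [Matrix.trace, Matrix.diag_apply, Matrix.mul_apply, Fintype.sum_prod_type,
      Matrix.submatrix_apply, charlieState_apply A r Φ hM, true_and, Matrix.kroneckerMap_apply]
    refine Finset.sum_congr rfl fun a _ => Finset.sum_congr rfl fun t _ => ?_
    simp only [ite_and, mul_ite, mul_zero, Finset.sum_ite_irrel, Finset.sum_const_zero,
      Finset.sum_ite_eq', Finset.mem_univ, if_true, Finset.mul_sum]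
    rw [Finset.sum_congr rfl fun c _ => Finset.sum_comm_cycle, Finset.sum_comm]
    refine Finset.sum_congr rfl fun b₁ _ => Finset.sum_congr rfl fun c _ => ?_
    rw [Finset.sum_comm]
    refine Finset.sum_congr rfl fun b _ => Finset.sum_congr rfl fun c₁ _ => ?_
    ring
  simp only [h1, Finset.mul_sum]
  rw [Finset.sum_comm]
  refine Finset.sum_congr rfl fun a _ => ?_
  rw [Finset.sum_comm]

/-- The probability that Bob and Charlie both guess correctly is at most `cos (π / 8) ^ n`. -/
theorem sum_trace_charlieState_le (hn : Even n)
    (hA : (A : Set (Submodule (ZMod 2) (Bits n))) = registerSubspaces n ∨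
      (A : Set (Submodule (ZMod 2) (Bits n))) = halfSubspaces n)
    [Fintype C] [DecidableEq C] {Φ : Op (Bits n) →ₗ[ℂ] Op (B × C)} (hΦ : IsChannel Φ)
    {M : Bits (n / 2) → Op (A × B)} (hM : IsPOVM M)
    {Q : Bits (n / 2) → Op (A × Bits (n / 2) × C)} (hQ : IsPOVM Q) :
    (∑ t', (Q t' * (charlieMarginal (partialGuess M (gameStateBob A r Φ))).submatrix
      (Prod.mk t') (Prod.mk t')).trace).re ≤ Real.cos (Real.pi / 8) ^ n := by
  have hhalf : ∀ a : A, (a : Submodule (ZMod 2) (Bits n)) ∈ halfSubspaces n := by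
    intro a
    have ha : (a : Submodule (ZMod 2) (Bits n)) ∈ (A : Set (Submodule (ZMod 2) (Bits n))) := a.2
    rcases hA with hA | hA
    · rw [hA] at ha; exact ha.1
    · rwa [hA] at ha
  obtain ⟨I, _, ⟨i₀⟩, Y, hY, hcover⟩ := exists_uniform_cover hn A hA
  rw [sum_trace_charlieState_eq A r Φ hM Q]
  set f : A → ℝ := fun a => (winEffect r a (fun t => (M t).submatrix (Prod.mk a) (Prod.mk a))
    (fun t t' => (Q t').submatrix (fun c => (a, t, c)) (fun c => (a, t, c))) *
      choi Φ).trace.re with hf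
  have hfam : ∀ i, ∑ θ, f (Y i θ) ≤ (1 + √(1 / 2)) ^ (n / 2) * 2 ^ n := by
    intro i
    have h := sum_trace_winEffect_le hn r (fun θ => (Y i θ : Submodule (ZMod 2) (Bits n)))
      (fun θ => hhalf _) (fun θ t => (M t).submatrix (Prod.mk (Y i θ)) (Prod.mk (Y i θ)))
      (fun θ => hM.submatrix fun _ _ h => (Prod.mk.inj h).2)
      (fun θ t t' => (Q t').submatrix (fun c => (Y i θ, t, c)) (fun c => (Y i θ, t, c)))
      (fun θ t => hQ.submatrix fun _ _ h => (Prod.mk.inj (Prod.mk.inj h).2).2)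
      (R := (1 + √(1 / 2)) ^ (n / 2)) (fun θ => le_of_eq ?_) (choi_posSemidef hΦ)
    · refine h.trans (le_of_eq ?_)
      rw [trace_choi hΦ, Complex.natCast_re]
      simp [ZMod.card]
    · rw [← sum_sqrt_overlap (n / 2) θ]
      simp only [hY, Nat.cast_pow, Nat.cast_ofNat]
  have hI : (0 : ℝ) < Fintype.card I := by
    exact_mod_cast Fintype.card_pos_iff.mpr ⟨i₀⟩
  have hAc : (0 : ℝ) < Fintype.card A := by
    exact_mod_cast Fintype.card_pos_iff.mpr ⟨Y i₀ fun _ => true⟩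
  have hsum : ∑ a, f a ≤ Fintype.card A * (Real.cos (Real.pi / 8) ^ n * 2 ^ n) := by
    have h1 : ∑ i, ∑ θ, f (Y i θ) ≤ Fintype.card I * ((1 + √(1 / 2)) ^ (n / 2) * 2 ^ n) := by
      refine (Finset.sum_le_card_nsmul _ _ _ fun i _ => hfam i).trans (le_of_eq ?_)
      rw [nsmul_eq_mul, Finset.card_univ]
    have h2 := hcover f
    rw [one_add_sqrt_half_pow hn] at h1
    have h3 : (Fintype.card I * 2 ^ (n / 2) : ℝ) * ∑ a, f a ≤ (Fintype.card I * 2 ^ (n / 2)) *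
        (Fintype.card A * (Real.cos (Real.pi / 8) ^ n * 2 ^ n)) := by
      rw [← h2]
      refine (mul_le_mul_of_nonneg_left h1 hAc.le).trans (le_of_eq (by ring))
    exact le_of_mul_le_mul_left h3 (by positivity)
  -- the `2 ^ n` pairs `(t, t')` of the uniform mixture cancel against the trace of the Choi matrix
  have hK : (Fintype.card (A × Bits (n / 2) × Bits (n / 2)) : ℝ) = Fintype.card A * 2 ^ n := by
    simp only [Fintype.card_prod, Fintype.card_fun, Fintype.card_fin, ZMod.card]
    obtain ⟨k, rfl⟩ := hn
    rw [show (k + k) / 2 = k by omega, ← pow_add]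
    push_cast
    ring
  rw [← Complex.ofReal_natCast, ← Complex.ofReal_inv, Complex.re_ofReal_mul, Complex.re_sum, hK]
  rw [inv_mul_le_iff₀ (by positivity)]
  exact hsum.trans (le_of_eq (by ring))

end Final
end CosetMoE

theorem mainTheorem2 (n : ℕ) (hn : Even n) [DecidableEq (Submodule (ZMod 2) (Bits n))]
    (A : Finset (Submodule (ZMod 2) (Bits n)))
    (hA : (A : Set (Submodule (ZMod 2) (Bits n))) = registerSubspaces n ∨
      (A : Set (Submodule (ZMod 2) (Bits n))) = halfSubspaces n)
    (r : CosetReps n)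
    {B C : Type*} [Fintype B] [DecidableEq B] [Fintype C]
    (Φ : Op (Bits n) →ₗ[ℂ] Op (B × C)) (hΦ : IsChannel Φ)
    (M : Bits (n / 2) → Op (A × B)) (hM : IsPOVM M) :
    (((-Real.logb 2 (Real.cos (Real.pi / 8))) * n - 1 / (2 * Real.log 2) : ℝ) : EReal) ≤
      HminGuess M (gameStateBob A r Φ) +
        Hmin (charlieMarginal (condState (partialGuess M (gameStateBob A r Φ)))) := by
  classical
  have hpos : (partialGuess M (gameStateBob A r Φ)).PosSemidef :=
    partialGuess_posSemidef M (gameStateBob_posSemidef A r hΦ)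
  set τ := charlieMarginal (partialGuess M (gameStateBob A r Φ)) with hτ
  have hτpos : τ.PosSemidef := charlieMarginal_posSemidef hpos
  obtain ⟨σ, hσ, hσtr⟩ := exists_posSemidef_ge_of_forall_isPOVM
    (fun t' => τ.submatrix (Prod.mk t') (Prod.mk t')) (fun t' => hτpos.submatrix _)
    fun Q hQ => sum_trace_charlieState_le A r hn hA hΦ hM hQ
  have hσpos : σ.PosSemidef := by
    have := (hσ 0).add (hτpos.submatrix (Prod.mk 0))
    rwa [sub_add_cancel] at this
  set p := (partialGuess M (gameStateBob A r Φ)).trace.re with hp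
  have hp0 : 0 ≤ p := (Complex.le_def.mp hpos.trace_nonneg).1
  have htr : (partialGuess M (gameStateBob A r Φ)).trace = (p : ℂ) :=
    Complex.ext rfl (Complex.le_def.mp hpos.trace_nonneg).2.symm
  have hcond : charlieMarginal (condState (partialGuess M (gameStateBob A r Φ))) =
      ∑ t', cstate t' ⊗ₖ (((p⁻¹ : ℝ) : ℂ) • τ.submatrix (Prod.mk t') (Prod.mk t')) := by
    rw [condState, charlieMarginal_smul, htr, ← Complex.ofReal_inv]
    ext ⟨t', a, t, c⟩ ⟨u', a₁, t₁, c₁⟩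
    rw [sum_cstate_kronecker_apply]
    split_ifs with h
    · have h' : t' = u' := h
      subst h'
      rfl
    · rw [Matrix.smul_apply, charlieState_apply A r Φ hM, if_neg fun h' => h h'.1, smul_zero]
  have hpinv : (0 : ℂ) ≤ ((p⁻¹ : ℝ) : ℂ) := by
    exact_mod_cast inv_nonneg.mpr hp0
  have hH : negLg (p⁻¹ * σ.trace.re) ≤
      Hmin (charlieMarginal (condState (partialGuess M (gameStateBob A r Φ)))) := by
    rw [hcond]
    have h := negLg_le_Hmin (fun t' => ((p⁻¹ : ℝ) : ℂ) • τ.submatrix (Prod.mk t') (Prod.mk t'))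
      (hσpos.smul hpinv) fun t' => by
        rw [← smul_sub]
        exact (hσ t').smul hpinv
    rwa [Matrix.trace_smul, smul_eq_mul, Complex.re_ofReal_mul] at h
  have hcos : 0 < Real.cos (Real.pi / 8) :=
    Real.cos_pos_of_mem_Ioo ⟨by linarith [Real.pi_pos], by linarith [Real.pi_pos]⟩
  -- if `p = 0`, then `p⁻¹ = 0` and the left-hand side vanishes
  have hmul : p * (p⁻¹ * σ.trace.re) ≤ Real.cos (Real.pi / 8) ^ n := by
    rcases hp0.eq_or_lt with h | h
    · rw [← h, zero_mul]; positivity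
    · rwa [mul_inv_cancel_left₀ h.ne']
  refine le_trans ?_ ((neg_logb_le_negLg_add_negLg hmul).trans (add_le_add le_rfl hH))
  rw [EReal.coe_le_coe_iff, Real.logb_pow]
  have : 0 < Real.log 2 := Real.log_pos one_lt_two
  have h2 : 0 ≤ 1 / (2 * Real.log 2) := by positivity
  linarith
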